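/- \textbf{Lemma (Strong reliability).} Let $d\ge 2$, let $\Gamma\subset\mathbb R^d$ and $\kappa>0$. There is a constant $C_{\rm rel}>0$, depending only on $d$, $\Gamma$ and $\kappa$, with the following property. \emph{Setting.} Let $\Omega\subset\mathbb R^d$ be a bounded Lipschitz domain with polyhedral boundary $\partial\Omega=\Gamma$, with $\operatorname{diam}(\Omega)<1$ if $d=2$. Let $G(x)=-\frac1{2\pi}\log|x|$ for $d=2$ and $G(x)=\frac{1}{(d-2)|\mathbb S_{d-1}|}|x|^{2-d}$ for $d\ge3$, where $|\mathbb S_{d-1}|$ is the surface area of the unit sphere in $\mathbb R^d$, and let $V\colon H^{-1/2}(\Gamma)\to H^{1/2}(\Gamma)$ be the single-layer operator, i.e. the continuous extension of $(V\psi)(x)=\int_\Gamma G(x-y)\psi(y)\,dy$; here $H^{-1/2}(\Gamma)$ is the dual space of $H^{1/2}(\Gamma)$, and the duality pairing $\langle\cdot,\cdot\rangle$ extends the $L^2(\Gamma)$-inner product. Let $g\in H^1(\Gamma)$ and let $\phi^\star\in H^{-1/2}(\Gamma)$ satisfy $\langle V\phi^\star,\psi\rangle=\langle g,\psi\rangle$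 for all $\psi\in H^{-1/2}(\Gamma)$. Let $\Omega_0\subseteq\Omega$ be a bounded polyhedral Lipschitz open set with $\Gamma\subseteq\partial\Omega_0$, and let $\mathcal T_\ell$ be a conforming triangulation of $\overline{\Omega_0}$ into $d$-simplices which is $\kappa$-shape regular, i.e. $\operatorname{diam}(T)\le\kappa\,h_T$ with $h_T:=|T|^{1/d}$ for all $T\in\mathcal T_\ell$; let $h_\ell$ be the mesh-size function, $h_\ell|_T=h_T$. (This covers every mesh generated by newest-vertex bisection from an initial mesh, if $\kappa$ is the corresponding shape-regularity constant.) Let $\mathcal T_\ell^\Gamma$ be the induced triangulation of $\Gamma$, consisting of all facets of elements of $\mathcal T_\ell$ that are contained in $\Gamma$. Let $p\in\mathbb N_0$, $q,k\in\mathbb N$, where $q, k\ge1$. Write $\mathcal P^p$ for piecewise polynomials and $\mathcal S^q$ for continuous piecewise polynomials of degree at most $p$ and $q$, respectively. \begin{itemize} \item Let $\phi_\ell^\star\in\mathcal P^p(\mathcal T_\ell^\Gamma)$ be the Galerkin solution: $\langle V\phi_\ell^\star,\psi_\ell\rangle=\langle g,\psi_\ell\rangle$ for all $\psi_\ell\in\mathcal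 P^p(\mathcal T_\ell^\Gamma)$. \item Let $J_\ell\colon L^2(\Gamma)\to\mathcal S^q(\mathcal T_\ell^\Gamma)$ be a Scott--Zhang projector: $J_\ell v=\sum_z\big(\int_{K_z}\psi_z v\,dx\big)\zeta_z$, where the sum is over the Lagrange nodes $z$ of $\mathcal S^q(\mathcal T_\ell^\Gamma)$, $(\zeta_z)$ is the nodal basis, $K_z\in\mathcal T_\ell^\Gamma$ is any facet with $z\in K_z$, and $\psi_z$ is the polynomial of degree at most $q$ on $K_z$ with $\int_{K_z}\psi_z\zeta_{z'}\,dx=\delta_{zz'}$ for all nodes $z'\in K_z$. \item Let $\mathcal T_\ell^\omega\subseteq\mathcal T_\ell$ be the $k$-patch of $\Gamma$: the $1$-patch of $\Gamma$ consists of all elements that intersect $\Gamma$, and the $(j+1)$-patch of all elements that intersect (the union of) the $j$-patch. Let $\omega_\ell$ be the interior of $\bigcup\mathcal T_\ell^\omega$. Let $w_\ell^\star\in\mathcal S^q(\mathcal T_\ell^\omega)$, extended by zero, satisfy $\int_{\omega_\ell}\nabla w_\ell^\star\cdot\nabla v_\ell\,dx=0$ for all $v_\ell\in\mathcal S^q(\mathcal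 T_\ell^\omega)$ with $v_\ell|_{\partial\omega_\ell}=0$, together with $w_\ell^\star|_\Gamma=J_\ell(g-V\phi_\ell^\star)$ and $w_\ell^\star=0$ on $\partial\omega_\ell\setminus\Gamma$. \item Define $\eta_\ell(T):=\|\nabla w_\ell^\star\|_{L^2(T)}$ for $T\in\mathcal T_\ell$, and ${\rm osc}_\ell:=\|h_\ell^{1/2}\nabla_\Gamma(1-J_\ell)(g-V\phi_\ell^\star)\|_{L^2(\Gamma)}$, where $\nabla_\Gamma$ is the surface gradient. \end{itemize} \emph{Claim.} For all $\psi\in L^2(\Gamma)$, \[ |\langle V\phi^\star-V\phi_\ell^\star,\psi\rangle_{H^{1/2}(\Gamma)\times H^{-1/2}(\Gamma)}| \le C_{\rm rel}\Big({\rm osc}_\ell\,\|\psi\|_{L^2(\Gamma)}+\sum_{T\in\mathcal T_\ell}\eta_\ell(T)\,\|\psi\|_{L^2(\partial T\cap\Gamma)}\Big). \] -/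

import Mathlib

open MeasureTheory Filter Topology
open scoped ENNReal NNReal ContDiff

noncomputable section

namespace BEM

/-! ### Domains, surface measure -/

/-- The Euclidean space `ℝ^d`. -/
abbrev Pt (d : ℕ) : Type := EuclideanSpace ℝ (Fin d)

/-- A bounded open set whose boundary is locally the graph of a Lipschitz function: near every
boundary point `x` there is a direction `ν` such that the set consists of the points whose height
`⟪y, ν⟫` lies above a Lipschitz function of the component `y - ⟪y, ν⟫ ν` orthogonal to `ν`. -/
structure IsBoundedLipschitz {d : ℕ} (Ω : Set (Pt d)) : Prop where
  isOpen : IsOpen Ω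
  isBounded : Bornology.IsBounded Ω
  graph : ∀ x ∈ frontier Ω, ∃ (ν : Pt d) (γ : Pt d → ℝ) (L : ℝ≥0) (r : ℝ),
    ‖ν‖ = 1 ∧ LipschitzWith L γ ∧ 0 < r ∧
      ∀ y ∈ Metric.ball x r, y ∈ Ω ↔ γ (y - inner ℝ y ν • ν) < inner ℝ y ν

/-- The (closed) simplex spanned by a finite set of vertices. -/
def hull {d : ℕ} (T : Finset (Pt d)) : Set (Pt d) := convexHull ℝ (T : Set (Pt d))

/-- A set that is a finite union of `(d-1)`-dimensional simplices. -/
def IsPolyhedralSurface {d : ℕ} (Γ : Set (Pt d)) : Prop :=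
  ∃ S : Finset (Finset (Pt d)),
    (∀ F ∈ S, F.card = d ∧ AffineIndependent ℝ ((↑) : F → Pt d)) ∧ Γ = ⋃ F ∈ S, hull F

/-- The `(d-1)`-dimensional Hausdorff measure on `ℝ^d`, normalised as the surface measure. -/
def surf (d : ℕ) : Measure (Pt d) := Measure.euclideanHausdorffMeasure (d - 1)

/-- Surface measure on `Γ`. -/
def sigma {d : ℕ} (Γ : Set (Pt d)) : Measure (Pt d) := (surf d).restrict Γ

/-! ### Sobolev spaces on the boundary -/

/-- The difference quotient of the Sobolev--Slobodeckij seminorm of order `1/2`: its square is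
`|v x - v y|^2 / |x - y|^d`. -/
def quot {d : ℕ} (v : Pt d → ℝ) (z : Pt d × Pt d) : ℝ :=
  (v z.1 - v z.2) / ‖z.1 - z.2‖ ^ ((d : ℝ) / 2)

theorem quot_add {d : ℕ} (v w : Pt d → ℝ) : quot (v + w) = quot v + quot w := by
  funext z; simp only [quot, Pi.add_apply]; ring

theorem quot_smul {d : ℕ} (c : ℝ) (v : Pt d → ℝ) : quot (c • v) = c • quot v := by
  funext z; simp only [quot, Pi.smul_apply, smul_eq_mul]; ring

theorem quot_zero {d : ℕ} : quot (0 : Pt d → ℝ) = 0 := by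
  funext z; simp [quot]

/-- Functions of class `H^{1/2}(Γ)`. -/
def hHalfSubmodule {d : ℕ} (Γ : Set (Pt d)) : Submodule ℝ (Pt d → ℝ) where
  carrier := {v | MemLp v 2 (sigma Γ) ∧ MemLp (quot v) 2 ((sigma Γ).prod (sigma Γ))}
  add_mem' := by
    rintro v w ⟨hv, hv'⟩ ⟨hw, hw'⟩
    exact ⟨hv.add hw, by rw [quot_add]; exact hv'.add hw'⟩
  zero_mem' := ⟨MemLp.zero, by rw [quot_zero]; exact MemLp.zero⟩
  smul_mem' := by
    rintro c v ⟨hv, hv'⟩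
    exact ⟨hv.const_smul c, by rw [quot_smul]; exact hv'.const_smul c⟩

/-- `H^{1/2}(Γ)`, as a seminormed space of functions (functions that agree almost everywhere on `Γ`
have distance zero). -/
def HHalf {d : ℕ} (Γ : Set (Pt d)) : Type := hHalfSubmodule Γ

instance {d : ℕ} (Γ : Set (Pt d)) : AddCommGroup (HHalf Γ) :=
  inferInstanceAs (AddCommGroup (hHalfSubmodule Γ))

instance {d : ℕ} (Γ : Set (Pt d)) : Module ℝ (HHalf Γ) :=
  inferInstanceAs (Module ℝ (hHalfSubmodule Γ))

/-- The underlying function of an element of `H^{1/2}(Γ)`. -/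
def HHalf.fn {d : ℕ} {Γ : Set (Pt d)} (v : HHalf Γ) : Pt d → ℝ := v.1

/-- `v ↦ (v, quot v)`, a linear map into `L^2(Γ) × L^2(Γ × Γ)`. -/
def HHalf.embed {d : ℕ} (Γ : Set (Pt d)) :
    HHalf Γ →ₗ[ℝ] WithLp 2 (Lp ℝ 2 (sigma Γ) × Lp ℝ 2 ((sigma Γ).prod (sigma Γ))) where
  toFun v := WithLp.toLp 2 (v.2.1.toLp v.1, v.2.2.toLp (quot v.1))
  map_add' v w := by
    have h : (v + w).2.2.toLp (quot (v + w).1)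
        = v.2.2.toLp (quot v.1) + w.2.2.toLp (quot w.1) := by
      rw [← MemLp.toLp_add]; congr 1; exact quot_add _ _
    rw [h]; rfl
  map_smul' c v := by
    have h : (c • v).2.2.toLp (quot (c • v).1) = c • v.2.2.toLp (quot v.1) := by
      rw [← MemLp.toLp_const_smul]; congr 1; exact quot_smul _ _
    rw [h]; rfl

/-- The norm is `‖v‖² = ‖v‖²_{L²(Γ)} + ∫_Γ ∫_Γ |v x - v y|² / |x - y|^d`. -/
instance {d : ℕ} (Γ : Set (Pt d)) : SeminormedAddCommGroup (HHalf Γ) :=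
  SeminormedAddCommGroup.induced (HHalf Γ) _ (HHalf.embed Γ)

instance {d : ℕ} (Γ : Set (Pt d)) : NormedSpace ℝ (HHalf Γ) :=
  NormedSpace.induced ℝ (HHalf Γ) _ (HHalf.embed Γ)

theorem HHalf.norm_sq {d : ℕ} {Γ : Set (Pt d)} (v : HHalf Γ) :
    ‖v‖ ^ 2 = (eLpNorm v.fn 2 (sigma Γ)).toReal ^ 2
      + (eLpNorm (quot v.fn) 2 ((sigma Γ).prod (sigma Γ))).toReal ^ 2 := by
  change ‖HHalf.embed Γ v‖ ^ 2 = _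
  rw [WithLp.prod_norm_sq_eq_of_L2]
  change ‖v.2.1.toLp v.1‖ ^ 2 + ‖v.2.2.toLp (quot v.1)‖ ^ 2 = _
  rw [Lp.norm_toLp, Lp.norm_toLp]
  rfl

/-- `H^{-1/2}(Γ)`, the dual space of `H^{1/2}(Γ)`, with its dual norm. -/
abbrev HMinusHalf {d : ℕ} (Γ : Set (Pt d)) : Type := StrongDual ℝ (HHalf Γ)

/-- The embedding of `H^{1/2}(Γ)` in `L^2(Γ)`. -/
def HHalf.toL2 {d : ℕ} (Γ : Set (Pt d)) : HHalf Γ →L[ℝ] Lp ℝ 2 (sigma Γ) :=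
  LinearMap.mkContinuous
    { toFun := fun v => v.2.1.toLp v.1
      map_add' := fun _ _ => rfl
      map_smul' := fun _ _ => rfl } 1 (by
    intro v
    have h := HHalf.norm_sq v
    change ‖v.2.1.toLp v.1‖ ≤ 1 * ‖v‖
    rw [Lp.norm_toLp, one_mul]
    refine le_of_sq_le_sq ?_ (norm_nonneg v)
    rw [h]
    exact le_add_of_nonneg_right (sq_nonneg _))

/-- A density `ψ ∈ L^2(Γ)` as the element `v ↦ ∫_Γ v ψ` of `H^{-1/2}(Γ)`. -/
def ofL2 {d : ℕ} {Γ : Set (Pt d)} (ψ : Pt d → ℝ) (hψ : MemLp ψ 2 (sigma Γ)) : HMinusHalf Γ :=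
  (innerSL ℝ (hψ.toLp ψ)).comp (HHalf.toL2 Γ)

theorem ofL2_apply {d : ℕ} {Γ : Set (Pt d)} (ψ : Pt d → ℝ) (hψ : MemLp ψ 2 (sigma Γ))
    (v : HHalf Γ) : ofL2 ψ hψ v = ∫ x, v.fn x * ψ x ∂(sigma Γ) := by
  change inner ℝ (hψ.toLp ψ) (v.2.1.toLp v.1) = _
  rw [L2.inner_def]
  refine integral_congr_ae ?_
  filter_upwards [hψ.coeFn_toLp, v.2.1.coeFn_toLp] with x h1 h2
  rw [h1, h2]
  rfl

/-- The tangential gradient on `Γ` of a smooth function on `ℝ^d`: the orthogonal projection of its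
gradient onto the tangent space of `Γ` (which is a hyperplane at almost every point of a Lipschitz
surface). -/
def tangGrad {d : ℕ} (Γ : Set (Pt d)) (f : Pt d → ℝ) (x : Pt d) : Pt d :=
  (Submodule.span ℝ (tangentConeAt ℝ Γ x)).starProjection (gradient f x)

/-- `v ∈ H^1(Γ)` with surface gradient `∇_Γ v = p`: some sequence of smooth functions converges to
`v` in `L^2(Γ)` while its tangential gradients converge to `p` in `L^2(Γ)`. -/
def HasSurfaceGradient {d : ℕ} (Γ : Set (Pt d)) (v : Pt d → ℝ) (p : Pt d → Pt d) : Prop :=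
  MemLp v 2 (sigma Γ) ∧ MemLp p 2 (sigma Γ) ∧ ∃ f : ℕ → Pt d → ℝ,
    (∀ n, ContDiff ℝ ∞ (f n)) ∧
    Tendsto (fun n => eLpNorm (f n - v) 2 (sigma Γ)) atTop (𝓝 0) ∧
    Tendsto (fun n => eLpNorm (tangGrad Γ (f n) - p) 2 (sigma Γ)) atTop (𝓝 0)

/-- Membership in `H^1(Γ)`. -/
def MemH1 {d : ℕ} (Γ : Set (Pt d)) (v : Pt d → ℝ) : Prop := ∃ p, HasSurfaceGradient Γ v p

/-! ### The single-layer operator -/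

/-- The fundamental solution of the Laplacian. -/
def fundSol (d : ℕ) (x : Pt d) : ℝ :=
  if d = 2 then -(1 / (2 * Real.pi)) * Real.log ‖x‖
  else 1 / (((d : ℝ) - 2) * (surf d).real (Metric.sphere 0 1)) * ‖x‖ ^ (2 - (d : ℝ))

/-- The integral `∫_Γ G(x - y) ψ(y) dy`. -/
def slIntegral {d : ℕ} (Γ : Set (Pt d)) (ψ : Pt d → ℝ) (x : Pt d) : ℝ :=
  ∫ y, fundSol d (x - y) * ψ y ∂(sigma Γ)

/-- `v` is the image of `φ` under the continuous extension to `H^{-1/2}(Γ) → H^{1/2}(Γ)` of the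
integral operator on `L^2(Γ)`. -/
def IsSingleLayer {d : ℕ} {Γ : Set (Pt d)} (φ : HMinusHalf Γ) (v : HHalf Γ) : Prop :=
  ∃ (f : ℕ → Pt d → ℝ) (hf : ∀ n, MemLp (f n) 2 (sigma Γ)) (u : ℕ → HHalf Γ),
    (∀ n, (u n).fn =ᵐ[sigma Γ] slIntegral Γ (f n)) ∧
    Tendsto (fun n => ofL2 (f n) (hf n)) atTop (𝓝 φ) ∧ Tendsto u atTop (𝓝 v)

open scoped Classical in
/-- The single-layer operator `V : H^{-1/2}(Γ) → H^{1/2}(Γ)`. -/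
def singleLayer {d : ℕ} {Γ : Set (Pt d)} (φ : HMinusHalf Γ) : HHalf Γ :=
  if h : ∃ v, IsSingleLayer φ v then h.choose else 0

/-! ### Meshes -/

/-- A finite conforming simplicial mesh in `ℝ^d`; elements are given by their vertex sets. -/
structure Mesh (d : ℕ) where
  elems : Finset (Finset (Pt d))
  card_eq : ∀ T ∈ elems, T.card = d + 1
  indep : ∀ T ∈ elems, AffineIndependent ℝ ((↑) : T → Pt d)
  conforming : ∀ T ∈ elems, ∀ T' ∈ elems,
    hull T ∩ hull T' = convexHull ℝ ((T : Set (Pt d)) ∩ (T' : Set (Pt d)))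

/-- The union of a family of simplices. -/
def cover {d : ℕ} (S : Finset (Finset (Pt d))) : Set (Pt d) := ⋃ T ∈ S, hull T

/-- The size `h_T = |T|^{1/d}` of an element. -/
def size {d : ℕ} (T : Finset (Pt d)) : ℝ := (volume.real (hull T)) ^ (1 / (d : ℝ))

/-- `κ`-shape regularity: `diam T ≤ κ |T|^{1/d}` for all elements. -/
def Mesh.ShapeRegular {d : ℕ} (M : Mesh d) (κ : ℝ) : Prop :=
  ∀ T ∈ M.elems, Metric.diam (hull T) ≤ κ * size T

/-- The mesh-size function, equal to `h_T` on `T` (the largest value at points shared by several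
elements). -/
def Mesh.h {d : ℕ} (M : Mesh d) (x : Pt d) : ℝ :=
  sSup {t | ∃ T ∈ M.elems, x ∈ hull T ∧ t = size T}

open scoped Classical in
/-- The boundary mesh: the facets of elements that are contained in `Γ`. -/
def Mesh.boundary {d : ℕ} (M : Mesh d) (Γ : Set (Pt d)) : Finset (Finset (Pt d)) :=
  (M.elems.biUnion fun T => T.powersetCard d).filter fun F => hull F ⊆ Γ

open scoped Classical in
/-- The elements that intersect the closure of `U`. -/
def Mesh.patch {d : ℕ} (M : Mesh d) (U : Set (Pt d)) : Finset (Finset (Pt d)) :=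
  M.elems.filter fun T => (hull T ∩ closure U).Nonempty

/-- The `k`-patch of `U`, for `k ≥ 1`. -/
def Mesh.kPatch {d : ℕ} (M : Mesh d) (U : Set (Pt d)) : ℕ → Finset (Finset (Pt d))
  | 0 => ∅
  | 1 => M.patch U
  | (k + 2) => M.patch (interior (cover (M.kPatch U (k + 1))))

/-! ### Discrete spaces -/

/-- Evaluation of a polynomial in `d` variables at a point. -/
def evalAt {d : ℕ} (P : MvPolynomial (Fin d) ℝ) (x : Pt d) : ℝ :=
  MvPolynomial.eval (fun i => x i) P

/-- `𝒫^p` on the boundary mesh `S` of `Γ`: functions in `L^2(Γ)` that are on every facet (almost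
everywhere) a polynomial of degree at most `p`. -/
def pwPoly {d : ℕ} (p : ℕ) (S : Finset (Finset (Pt d))) (Γ : Set (Pt d)) : Set (Pt d → ℝ) :=
  {φ | MemLp φ 2 (sigma Γ) ∧ ∀ F ∈ S, ∃ P : MvPolynomial (Fin d) ℝ, P.totalDegree ≤ p ∧
    ∀ᵐ x ∂((surf d).restrict (hull F)), φ x = evalAt P x}

/-- `𝒮^q` on a family `S` of simplices: continuous functions on their union that are on every simplex
a polynomial of degree at most `q`. (Values outside the union are irrelevant; continuity on the
finite union of the closed simplices follows from continuity on each of them.) -/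
def spline {d : ℕ} (q : ℕ) (S : Finset (Finset (Pt d))) : Set (Pt d → ℝ) :=
  {v | ∀ T ∈ S, ∃ P : MvPolynomial (Fin d) ℝ, P.totalDegree ≤ q ∧ ∀ x ∈ hull T, v x = evalAt P x}

theorem continuousOn_of_mem_spline {d q : ℕ} {S : Finset (Finset (Pt d))} {v : Pt d → ℝ}
    (hv : v ∈ spline q S) : ContinuousOn v (cover S) := by
  refine LocallyFinite.continuousOn_iUnion (f := fun T : S => hull T.1) ?_ ?_ ?_ |>.mono ?_
  · exact locallyFinite_of_finite _
  · exact fun T => (T.1.finite_toSet.isCompact_convexHull (𝕜 := ℝ)).isClosed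
  · intro T
    obtain ⟨P, -, hP⟩ := hv T.1 T.2
    refine ContinuousOn.congr (f := evalAt P) ?_ hP
    refine Continuous.continuousOn ?_
    exact (MvPolynomial.continuous_eval P).comp (by fun_prop)
  · intro x hx
    simp only [cover, Set.mem_iUnion, exists_prop] at hx
    obtain ⟨T, hT, hxT⟩ := hx
    exact Set.mem_iUnion.2 ⟨⟨T, hT⟩, hxT⟩

open scoped Classical in
/-- The Lagrange nodes of degree `q ≥ 1`: the points `∑_{z ∈ T} (α_z / q) z` for simplices `T` and
multi-indices `α` on the vertices of `T` with `|α| = q`. -/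
def nodes {d : ℕ} (q : ℕ) (S : Finset (Finset (Pt d))) : Finset (Pt d) :=
  S.biUnion fun T => (T.piAntidiag q).image fun α => ∑ z ∈ T, ((α z : ℝ) / (q : ℝ)) • z

open scoped Classical in
/-- The data of a Scott--Zhang projector onto `𝒮^q` on a surface mesh `S`: the nodal basis `ζ`, for
every Lagrange node `z` a simplex `K z` of `S` that contains `z`, and the polynomial `ψ z` on
`K z` that is dual to the nodal basis functions of the nodes in `K z`. The choice of `K` is free. -/
structure ScottZhang {d : ℕ} (q : ℕ) (S : Finset (Finset (Pt d))) where
  ζ : Pt d → Pt d → ℝ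
  ζ_mem : ∀ z ∈ nodes q S, ζ z ∈ spline q S
  ζ_node : ∀ z ∈ nodes q S, ∀ z' ∈ nodes q S, ζ z z' = if z = z' then 1 else 0
  K : Pt d → Finset (Pt d)
  K_mem : ∀ z ∈ nodes q S, K z ∈ S
  mem_K : ∀ z ∈ nodes q S, z ∈ hull (K z)
  ψ : Pt d → Pt d → ℝ
  ψ_poly : ∀ z ∈ nodes q S, ψ z ∈ spline q {K z}
  ψ_dual : ∀ z ∈ nodes q S, ∀ z' ∈ nodes q S, z' ∈ hull (K z) →
    ∫ x in hull (K z), ψ z x * ζ z' x ∂(surf d) = if z = z' then 1 else 0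

/-- The Scott--Zhang projector `J v = ∑_z (∫_{K z} ψ_z v) ζ_z`. -/
def ScottZhang.proj {d q : ℕ} {S : Finset (Finset (Pt d))} (J : ScottZhang q S)
    (v : Pt d → ℝ) (x : Pt d) : ℝ :=
  ∑ z ∈ nodes q S, (∫ y in hull (J.K z), J.ψ z y * v y ∂(surf d)) * J.ζ z x

/-! ### Boundary element method and error estimator -/

/-- `φ` solves the boundary integral equation `⟨V φ, χ⟩ = ⟨g, χ⟩` for all `χ ∈ H^{-1/2}(Γ)`. -/
def IsExactDensity {d : ℕ} {Γ : Set (Pt d)} (g : HHalf Γ) (φ : HMinusHalf Γ) : Prop :=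
  ∀ χ : HMinusHalf Γ, χ (singleLayer φ) = χ g

/-- `φ ∈ 𝒫^p` solves the Galerkin equations `⟨V φ, χ⟩ = ⟨g, χ⟩` for all `χ ∈ 𝒫^p`. -/
def IsGalerkin {d : ℕ} {Γ : Set (Pt d)} (p : ℕ) (S : Finset (Finset (Pt d))) (g : HHalf Γ)
    (φ : Pt d → ℝ) (hφ : φ ∈ pwPoly p S Γ) : Prop :=
  ∀ (χ : Pt d → ℝ) (hχ : χ ∈ pwPoly p S Γ),
    ofL2 χ hχ.1 (singleLayer (ofL2 φ hφ.1)) = ofL2 χ hχ.1 g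

/-- `w` is the solution, extended by zero, of the discrete auxiliary problem on the strip `ω`, the
interior of the union of the elements in `S`: `w ∈ 𝒮^q` is discrete harmonic, with boundary values
`b` on `Γ` and zero on the rest `∂ω \ Γ` of the boundary. -/
structure IsAuxSolution {d : ℕ} (q : ℕ) (S : Finset (Finset (Pt d))) (Γ : Set (Pt d))
    (b : Pt d → ℝ) (w : Pt d → ℝ) : Prop where
  mem : w ∈ spline q S
  zero_off : ∀ x, x ∉ cover S → w x = 0
  weak : ∀ v ∈ spline q S, (∀ x ∈ frontier (interior (cover S)), v x = 0) →
    ∫ x in interior (cover S), inner ℝ (gradient w x) (gradient v x) = 0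
  eq_inner : ∀ x ∈ Γ, w x = b x
  eq_outer : ∀ x ∈ frontier (interior (cover S)) \ Γ, w x = 0

/-- The element contribution `η(T) = ‖∇w‖_{L²(T)}`. -/
def eta {d : ℕ} (w : Pt d → ℝ) (T : Finset (Pt d)) : ℝ≥0∞ :=
  eLpNorm (gradient w) 2 (volume.restrict (hull T))

/-- The norm `‖h^{1/2} ∇_Γ v‖_{L²(Γ)}`, which is infinite if `v ∉ H^1(Γ)` (the surface gradient of
`v ∈ H^1(Γ)` is unique almost everywhere). -/
def oscNorm {d : ℕ} (M : Mesh d) (Γ : Set (Pt d)) (v : Pt d → ℝ) : ℝ≥0∞ :=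
  ⨅ (p : Pt d → Pt d) (_ : HasSurfaceGradient Γ v p),
    eLpNorm (fun x => (M.h x) ^ (1 / 2 : ℝ) • p x) 2 (sigma Γ)

end BEM

end

noncomputable section

namespace BEM

open AffineMap (lineMap homothety)

/-! Let `e = g - Vφ_ℓ` be the residual. Testing the exact equation with `ψ` replaces `Vφ*` by `g`,
so the pairing equals `∫ e ψ` over `Γ`, and it suffices to bound `e` in `L²` on each boundary facet
`F` and to sum.

The indicator of `F` is an admissible Galerkin test function, so `e` has mean zero on `F`, and its
`L²(F)` norm is its distance to the constants. Split `e = (1 - J)e + Je`, and note that `Je = w` on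
`F`. If `F` is a facet of the element `T`, the Poincaré inequality on `F` puts the first summand
within `C h_T ‖∇_Γ(1 - J)e‖_F` of a constant, and a trace form of it on `T` puts the second within
`C h_T^{1/2} ‖∇w‖_T` of a constant (`Mesh.eLpNorm_facet_le`). Both inequalities hold for all smooth
functions, with constants depending on `d` and `κ` only, so the polynomial degrees do not enter.
With `h^{1/2}` moved into the oscillation, each bound keeps a spare factor `h_T^{1/2}`. It is
bounded in terms of `Γ`, because `Ω` lies in every ball about the origin that contains `Γ`.
Cauchy–Schwarz over the facets yields the oscillation term; the other sum loses at most the factor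
`d + 1`, the number of facets of a simplex (`Mesh.lintegral_enorm_mul_le`).

The two inequalities come from estimates of `∫∫ |f x - f y|²`. On a facet, `f x - f y` is the
integral of the tangential gradient along the segment, and homotheties scale the surface measure by
a power of their ratio. On an element, regarded as a cone over `F` with apex `a`, one goes from `x`
to `y` by moving towards `a`, then parallel to `F`, then back, and averages over the depth.

The summation needs facts about `Γ`: the facets contained in `Γ` exhaust it up to a null set
(`Mesh.sigma_eq_restrict_iUnion`), they overlap in null sets, and the tangential gradient on a facet
is the projection to its direction (`Mesh.tangGrad_ae_eq`). The first rests on the fact that a facet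
whose relative interior meets `∂Ω` lies in `∂Ω`. -/

theorem lintegral_sq_le {α : Type*} [MeasurableSpace α] (μ : Measure α) {f : α → ℝ≥0∞}
    (hf : AEMeasurable f μ) : (∫⁻ x, f x ∂μ) ^ 2 ≤ μ Set.univ * ∫⁻ x, f x ^ 2 ∂μ := by
  have h := ENNReal.lintegral_mul_le_Lp_mul_Lq μ Real.HolderConjugate.two_two hf
    (aemeasurable_const (b := (1 : ℝ≥0∞)))
  simp only [Pi.mul_apply, mul_one, ENNReal.one_rpow, lintegral_const, one_mul] at h
  calc (∫⁻ x, f x ∂μ) ^ 2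
      ≤ ((∫⁻ x, f x ^ (2 : ℝ) ∂μ) ^ (1 / 2 : ℝ) * μ Set.univ ^ (1 / 2 : ℝ)) ^ 2 := by gcongr
    _ = μ Set.univ * ∫⁻ x, f x ^ 2 ∂μ := by
      rw [mul_pow, ← ENNReal.rpow_natCast, ← ENNReal.rpow_natCast, ← ENNReal.rpow_mul,
        ← ENNReal.rpow_mul, mul_comm]
      norm_num

/-- Fundamental theorem of calculus followed by Cauchy–Schwarz. -/
theorem enorm_sub_sq_le_lintegral {h h' : ℝ → ℝ} {a b : ℝ} (hab : a ≤ b)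
    (hd : ∀ t, HasDerivAt h (h' t) t) (hc : Continuous h') :
    ‖h b - h a‖ₑ ^ 2 ≤ ENNReal.ofReal (b - a) * ∫⁻ t in Set.Ioc a b, ‖h' t‖ₑ ^ 2 := by
  have h1 : h b - h a = ∫ t in Set.Ioc a b, h' t := by
    rw [← intervalIntegral.integral_of_le hab,
      intervalIntegral.integral_eq_sub_of_hasDerivAt (fun t _ => hd t) (hc.intervalIntegrable _ _)]
  rw [h1]
  calc ‖∫ t in Set.Ioc a b, h' t‖ₑ ^ 2 ≤ (∫⁻ t in Set.Ioc a b, ‖h' t‖ₑ) ^ 2 := by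
        gcongr; exact enorm_integral_le_lintegral_enorm _
    _ ≤ _ := by
        refine (lintegral_sq_le _ hc.measurable.enorm.aemeasurable).trans_eq ?_
        simp

/-! ### Poincaré inequality on convex sets by integration along segments -/

section

set_option linter.unusedSectionVars false

variable {E : Type*} [NormedAddCommGroup E] [InnerProductSpace ℝ E] [FiniteDimensional ℝ E]
  [MeasurableSpace E] [BorelSpace E]

/-- The integral of the squared tangential gradient bounds the squared increment of a function
along a segment. -/
theorem enorm_sub_lineMap_sq_le {f : E → ℝ} (hf : ContDiff ℝ 1 f) (V : Submodule ℝ E) {a x : E}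
    (hV : x - a ∈ V) {D : ℝ} (hD : ‖x - a‖ ≤ D) {s t : ℝ} (hst : s ≤ t) (h1 : t - s ≤ 1) :
    ‖f (lineMap a x t) - f (lineMap a x s)‖ₑ ^ 2 ≤ ENNReal.ofReal D ^ 2 *
      ∫⁻ τ in Set.Ioc s t, ‖V.starProjection (gradient f (lineMap a x τ))‖ₑ ^ 2 := by
  have hfd : Differentiable ℝ f := hf.differentiable (by simp)
  have hg : Continuous (gradient f) :=
    (InnerProductSpace.toDual ℝ E).symm.continuous.comp (hf.continuous_fderiv (by simp))
  have hline : Continuous (fun τ : ℝ => (lineMap a x τ : E)) := AffineMap.lineMap_continuous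
  have hd : ∀ τ : ℝ, HasDerivAt (fun τ => f (lineMap a x τ))
      (inner ℝ (V.starProjection (gradient f (lineMap a x τ))) (x - a)) τ := by
    intro τ
    have h2 := (hfd (lineMap a x τ)).hasGradientAt.hasFDerivAt.comp_hasDerivAt τ
      (AffineMap.hasDerivAt_lineMap (a := a) (b := x) (x := τ))
    -- Only the component of the gradient in `V` is seen, because the direction `x - a` of the
    -- segment lies in `V`.
    have h4 : inner ℝ (V.starProjection (gradient f (lineMap a x τ))) (x - a)
        = InnerProductSpace.toDual ℝ E (gradient f (lineMap a x τ)) (x - a) := by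
      rw [InnerProductSpace.toDual_apply_apply, Submodule.inner_starProjection_left_eq_right,
        Submodule.starProjection_eq_self_iff.2 hV]
    rw [h4]
    exact h2
  refine (enorm_sub_sq_le_lintegral hst hd (by fun_prop)).trans ?_
  have h3 : ∀ τ : ℝ, ‖(inner ℝ (V.starProjection (gradient f (lineMap a x τ))) (x - a) : ℝ)‖ₑ ^ 2
      ≤ ENNReal.ofReal D ^ 2 * ‖V.starProjection (gradient f (lineMap a x τ))‖ₑ ^ 2 := by
    intro τ
    rw [← mul_pow]
    gcongr
    rw [← ofReal_norm, ← ofReal_norm, ← ENNReal.ofReal_mul ((norm_nonneg _).trans hD)]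
    refine ENNReal.ofReal_le_ofReal ((norm_inner_le_norm _ _).trans ?_)
    rw [mul_comm]
    gcongr
  calc _ ≤ 1 * ∫⁻ τ in Set.Ioc s t, ENNReal.ofReal D ^ 2 *
          ‖V.starProjection (gradient f (lineMap a x τ))‖ₑ ^ 2 := by
        gcongr with τ
        · simpa using h1
        · exact h3 τ
    _ = _ := by
        rw [one_mul, lintegral_const_mul]
        exact (V.starProjection.continuous.comp (hg.comp hline)).enorm.measurable.pow_const 2

theorem measurable_lineMap_right (a : E) (t : ℝ) : Measurable (fun y : E => lineMap a y t) := by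
  simp only [AffineMap.lineMap_apply_module]
  fun_prop

theorem measurable_lineMap_uncurry (a : E) :
    Measurable (fun z : ℝ × E => lineMap a z.2 z.1) := by
  simp only [AffineMap.lineMap_apply_module]
  fun_prop

/-- Pulling back along a homothety multiplies integrals over a set which the homothety maps into
itself by at most the power of the inverse ratio. -/
theorem lintegral_lineMap_le (n : ℕ) {K K' : Set E} (hK : MeasurableSet K)
    {G : E → ℝ≥0∞} (hG : Measurable G) (hK' : MeasurableSet K') (a : E) {t : ℝ} (ht : 0 < t)
    (hmaps : ∀ y ∈ K, lineMap a y t ∈ K') :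
    ∫⁻ y in K, G (lineMap a y t) ∂(μHE[n]) ≤ ENNReal.ofReal (t⁻¹ ^ n) * ∫⁻ y in K', G y ∂(μHE[n]) := by
  have hm := measurable_lineMap_right a t
  have hmap : (μHE[n] : Measure E).map (fun y => lineMap a y t)
      = ENNReal.ofReal (t⁻¹ ^ n) • (μHE[n] : Measure E) := by
    ext s hs
    rw [Measure.map_apply hm hs]
    have h := MeasureTheory.euclideanHausdorffMeasure_homothety_preimage (𝕜 := ℝ) n a ht.ne' s
    have h2 : (fun y => lineMap a y t) ⁻¹' s = homothety a t ⁻¹' s := by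
      ext y; simp [AffineMap.homothety_eq_lineMap]
    rw [h2, h, Measure.smul_apply, ENNReal.smul_def, smul_eq_mul, smul_eq_mul]
    congr 1
    rw [ENNReal.coe_pow, ENNReal.ofReal_pow (by positivity), ← Real.enorm_of_nonneg (by positivity),
      enorm_eq_nnnorm]
    simp
  calc ∫⁻ y in K, G (lineMap a y t) ∂(μHE[n])
      = ∫⁻ y, K.indicator (fun y => G (lineMap a y t)) y ∂(μHE[n]) := (lintegral_indicator hK _).symm
    _ ≤ ∫⁻ y, K'.indicator G (lineMap a y t) ∂(μHE[n]) := by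
        refine lintegral_mono fun y => ?_
        by_cases hy : y ∈ K
        · simp [hy, hmaps y hy]
        · simp [hy]
    _ = ∫⁻ y, K'.indicator G y ∂((μHE[n] : Measure E).map (fun y => lineMap a y t)) :=
        (lintegral_map (hG.indicator hK') hm).symm
    _ = _ := by rw [hmap, lintegral_smul_measure, lintegral_indicator hK', smul_eq_mul]

/-- The averages of a function over the segments between the points of a convex set. -/
theorem lintegral_segment_le (n : ℕ) {K : Set E} (hK : MeasurableSet K) (hKc : Convex ℝ K)
    (hfin : (μHE[n] : Measure E) K ≠ ⊤) {G : E → ℝ≥0∞} (hG : Measurable G) :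
    ∫⁻ x in K, ∫⁻ y in K, (∫⁻ t in Set.Ioc (0 : ℝ) 1, G (lineMap x y t)) ∂(μHE[n]) ∂(μHE[n])
      ≤ 2 ^ n * (μHE[n] : Measure E) K * ∫⁻ y in K, G y ∂(μHE[n]) := by
  set ν := (μHE[n] : Measure E).restrict K with hν
  have : IsFiniteMeasure ν := ⟨by simpa [hν] using hfin.lt_top⟩
  have hcont : Measurable (fun z : (E × E) × ℝ => G (lineMap z.1.1 z.1.2 z.2)) := by
    refine hG.comp ?_
    simp only [AffineMap.lineMap_apply_module]
    fun_prop
  have half : ∀ t : ℝ, 1 / 2 ≤ t → ∀ a ∈ K, t ≤ 1 →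
      ∫⁻ y, G (lineMap a y t) ∂ν ≤ 2 ^ n * ∫⁻ y, G y ∂ν := by
    intro t ht a ha ht1
    refine (lintegral_lineMap_le n hK hG hK a (by linarith)
      (fun y hy => hKc.lineMap_mem ha hy ⟨by linarith, ht1⟩)).trans ?_
    gcongr
    rw [ENNReal.ofReal_pow (inv_nonneg.2 (by linarith))]
    gcongr
    refine (ENNReal.ofReal_le_ofReal (inv_anti₀ (by norm_num) ht)).trans ?_
    simp
  have key : ∀ t ∈ Set.Ioc (0 : ℝ) 1, ∫⁻ x, ∫⁻ y, G (lineMap x y t) ∂ν ∂ν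
      ≤ 2 ^ n * ν Set.univ * ∫⁻ y, G y ∂ν := by
    intro t ht
    -- For `t ≥ 1/2` contract towards `x`; for `t ≤ 1/2` exchange the integrals and contract towards
    -- `y` with ratio `1 - t`. The ratio is at least `1/2` either way, so the loss is at most `2 ^
    -- n`.
    rcases le_total (1 / 2) t with h | h
    · calc _ ≤ ∫⁻ x, 2 ^ n * ∫⁻ y, G y ∂ν ∂ν := by
            refine lintegral_mono_ae ((ae_restrict_iff' hK).2 (.of_forall fun x hx => ?_))
            exact half t h x hx ht.2
        _ = _ := by rw [lintegral_const]; ring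
    · have hm : Measurable (fun z : E × E => G (lineMap z.1 z.2 t)) :=
        hcont.comp (measurable_id.prodMk measurable_const)
      rw [lintegral_lintegral_swap hm.aemeasurable]
      calc _ ≤ ∫⁻ x, 2 ^ n * ∫⁻ y, G y ∂ν ∂ν := by
            refine lintegral_mono_ae ((ae_restrict_iff' hK).2 (.of_forall fun y hy => ?_))
            have := half (1 - t) (by linarith) y hy (by linarith [ht.1])
            refine le_trans (le_of_eq ?_) this
            refine lintegral_congr fun x => ?_
            rw [AffineMap.lineMap_apply_one_sub]
        _ = _ := by rw [lintegral_const]; ring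
  calc _ = ∫⁻ x, (∫⁻ t in Set.Ioc (0 : ℝ) 1, ∫⁻ y, G (lineMap x y t) ∂ν) ∂ν := by
        refine lintegral_congr fun x => ?_
        refine lintegral_lintegral_swap (Measurable.aemeasurable ?_)
        exact hcont.comp (f := fun z : E × ℝ => ((x, z.1), z.2)) (by fun_prop)
    _ = ∫⁻ t in Set.Ioc (0 : ℝ) 1, ∫⁻ x, ∫⁻ y, G (lineMap x y t) ∂ν ∂ν := by
        refine lintegral_lintegral_swap (Measurable.aemeasurable ?_)
        refine Measurable.lintegral_prod_right' (ν := ν)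
          (f := fun z : (E × ℝ) × E => G (lineMap z.1.1 z.2 z.1.2)) ?_
        exact hcont.comp (f := fun z : (E × ℝ) × E => ((z.1.1, z.2), z.1.2)) (by fun_prop)
    _ ≤ ∫⁻ t in Set.Ioc (0 : ℝ) 1, 2 ^ n * ν Set.univ * ∫⁻ y, G y ∂ν := by
        refine lintegral_mono_ae ((ae_restrict_iff' measurableSet_Ioc).2 (.of_forall key))
    _ = _ := by simp [hν]

/-- The Poincaré inequality on a convex set, for the mean square difference of two values. -/
theorem lintegral_enorm_sub_sq_le (n : ℕ) {K : Set E} (hK : MeasurableSet K) (hKc : Convex ℝ K)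
    (hfin : (μHE[n] : Measure E) K ≠ ⊤) {G : E → ℝ≥0∞} (hG : Measurable G) {f : E → ℝ}
    {c : ℝ≥0∞} (hfG : ∀ x ∈ K, ∀ y ∈ K,
      ‖f x - f y‖ₑ ^ 2 ≤ c * ∫⁻ t in Set.Ioc (0 : ℝ) 1, G (lineMap x y t)) :
    ∫⁻ x in K, ∫⁻ y in K, ‖f x - f y‖ₑ ^ 2 ∂(μHE[n]) ∂(μHE[n])
      ≤ c * (2 ^ n * (μHE[n] : Measure E) K * ∫⁻ y in K, G y ∂(μHE[n])) := by
  set ν := (μHE[n] : Measure E).restrict K with hν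
  have : IsFiniteMeasure ν := ⟨by simpa [hν] using hfin.lt_top⟩
  have hcont : Measurable (fun z : (E × E) × ℝ => G (lineMap z.1.1 z.1.2 z.2)) := by
    refine hG.comp ?_
    simp only [AffineMap.lineMap_apply_module]
    fun_prop
  set A : E × E → ℝ≥0∞ := fun z => ∫⁻ t in Set.Ioc (0 : ℝ) 1, G (lineMap z.1 z.2 t)
  have hm : Measurable A := hcont.lintegral_prod_right'
  have h1 : ∀ x, Measurable (fun y => A (x, y)) := fun x => hm.comp measurable_prodMk_left
  have h2 : Measurable (fun x => ∫⁻ y, A (x, y) ∂ν) := hm.lintegral_prod_right'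
  have h3 : ∫⁻ x, ∫⁻ y, A (x, y) ∂ν ∂ν ≤ 2 ^ n * (μHE[n] : Measure E) K * ∫⁻ y, G y ∂ν :=
    lintegral_segment_le n hK hKc hfin hG
  have h4 : ∫⁻ x, ∫⁻ y, ‖f x - f y‖ₑ ^ 2 ∂ν ∂ν ≤ ∫⁻ x, ∫⁻ y, c * A (x, y) ∂ν ∂ν :=
    setLIntegral_mono' hK fun x hx => setLIntegral_mono' hK fun y hy => hfG x hx y hy
  refine h4.trans ?_
  simp_rw [lintegral_const_mul c (h1 _), lintegral_const_mul c h2]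
  exact mul_le_mul_right h3 c

end

/-! ### Slicing by hyperplanes and the trace inequality on a cone -/

section

set_option linter.unusedSectionVars false

variable {E : Type*} [NormedAddCommGroup E] [InnerProductSpace ℝ E] [FiniteDimensional ℝ E]
  [MeasurableSpace E] [BorelSpace E]

/-- The surface measure of a bounded subset of a hyperplane. -/
theorem measure_le_of_subset_hyperplane {n : ℕ} (hn : Module.finrank ℝ E = n + 1) {v : E}
    (hv : v ≠ 0) {A : Set E} (hA : ∀ x ∈ A, ∀ y ∈ A, inner ℝ v (x - y) = 0) {D : ℝ} (hD0 : 0 ≤ D)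
    (hD : ∀ x ∈ A, ∀ y ∈ A, ‖x - y‖ ≤ D) :
    (μHE[n] : Measure E) A ≤
      ENNReal.ofReal D ^ n * volume (Metric.closedBall (0 : EuclideanSpace ℝ (Fin n)) 1) := by
  rcases A.eq_empty_or_nonempty with rfl | ⟨q, hq⟩
  · simp
  have : Fact (Module.finrank ℝ E = n + 1) := ⟨hn⟩
  let b := OrthonormalBasis.fromOrthogonalSpanSingleton (𝕜 := ℝ) n hv
  let f : EuclideanSpace ℝ (Fin n) → E := fun u => q + (b.repr.symm u : E)
  have hf : Isometry f := by
    refine Isometry.of_dist_eq fun u u' => ?_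
    simp only [f, dist_add_left]
    rw [← Subtype.dist_eq, b.repr.symm.dist_map]
  have hsub : A ⊆ f '' Metric.closedBall 0 D := by
    intro x hx
    have hx' : x - q ∈ (ℝ ∙ v)ᗮ := (Submodule.mem_orthogonal_singleton_iff_inner_right).2 (hA x hx q hq)
    refine ⟨b.repr ⟨x - q, hx'⟩, ?_, ?_⟩
    · rw [mem_closedBall_zero_iff, b.repr.norm_map]
      exact hD x hx q hq
    · simp [f]
  calc (μHE[n] : Measure E) A ≤ μHE[n] (f '' Metric.closedBall 0 D) := measure_mono hsub
    _ = volume (Metric.closedBall (0 : EuclideanSpace ℝ (Fin n)) D) := by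
        rw [hf.euclideanHausdorffMeasure_image, EuclideanSpace.euclideanHausdorffMeasure_eq_volume]
    _ = _ := by
        rw [Measure.addHaar_closedBall' _ _ hD0, finrank_euclideanSpace_fin, ENNReal.ofReal_pow hD0]

/-- Fubini along the normal `v`. The slice with parameter `s` is the hyperplane through `a + s v`,
so the factor `‖v‖` is the Jacobian of `s ↦ s v`. -/
theorem volume_eq_lintegral_slice {n : ℕ} (hn : Module.finrank ℝ E = n + 1) (a : E) {v : E}
    (hv : v ≠ 0) {t : Set E} (ht : MeasurableSet t) :
    volume t = ‖v‖ₑ * ∫⁻ s : ℝ, (μHE[n] : Measure E) (t ∩ {x | inner ℝ v (x - a) = s * ‖v‖ ^ 2}) := by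
  have h := EuclideanGeometry.euclideanHausdorffMeasure_eq_lintegral a hv ht
  rw [InnerProductSpace.euclideanHausdorffMeasure_eq_volume, hn, Nat.add_sub_cancel] at h
  rw [h]
  congr 1
  refine lintegral_congr fun s => ?_
  congr 2
  ext x
  rw [SetLike.mem_coe, AffineSubspace.mem_mk', Submodule.mem_orthogonal_singleton_iff_inner_right]
  simp only [vsub_eq_sub, vadd_eq_add, Set.mem_ofPred_eq, ← sub_eq_zero (b := s * ‖v‖ ^ 2)]
  rw [show x - (s • v + a) = (x - a) - s • v by abel, inner_sub_right, inner_smul_right,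
    real_inner_self_eq_norm_sq]

/-- The volume of a set between two parallel hyperplanes. -/
theorem volume_le_of_subset_slab {n : ℕ} (hn : Module.finrank ℝ E = n + 1) (a : E) {v : E}
    (hv : v ≠ 0) {T : Set E} (hT : MeasurableSet T)
    (hslab : ∀ x ∈ T, 0 ≤ inner ℝ v (x - a) ∧ inner ℝ v (x - a) ≤ ‖v‖ ^ 2) {D : ℝ} (hD0 : 0 ≤ D)
    (hD : ∀ x ∈ T, ∀ y ∈ T, ‖x - y‖ ≤ D) :
    volume T ≤ ‖v‖ₑ * (ENNReal.ofReal D ^ n *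
      volume (Metric.closedBall (0 : EuclideanSpace ℝ (Fin n)) 1)) := by
  have hv2 : 0 < ‖v‖ ^ 2 := by positivity
  rw [volume_eq_lintegral_slice hn a hv hT]
  gcongr
  set c := ENNReal.ofReal D ^ n * volume (Metric.closedBall (0 : EuclideanSpace ℝ (Fin n)) 1)
  calc _ ≤ ∫⁻ s : ℝ, (Set.Icc (0 : ℝ) 1).indicator (fun _ => c) s := by
        refine lintegral_mono fun s => ?_
        by_cases hs : s ∈ Set.Icc (0 : ℝ) 1
        · rw [Set.indicator_of_mem hs]
          refine measure_le_of_subset_hyperplane hn hv (fun x hx y hy => ?_) hD0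
            fun x hx y hy => hD x hx.1 y hy.1
          have h1 := hx.2
          have h2 := hy.2
          simp only [Set.mem_ofPred_eq, inner_sub_right] at h1 h2 ⊢
          linarith
        · rw [Set.indicator_of_notMem hs]
          refine le_of_eq (measure_mono_null ?_ measure_empty)
          rintro x ⟨hx, hx2⟩
          obtain ⟨h1, h2⟩ := hslab x hx
          simp only [Set.mem_ofPred_eq] at hx2
          rw [hx2] at h1 h2
          exact hs ⟨nonneg_of_mul_nonneg_left h1 hv2, by
            by_contra h; nlinarith⟩
    _ = c := by simp [lintegral_indicator measurableSet_Icc]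

/-- Integration over the part of a cone that lies near its base. -/
theorem lintegral_cone_le {n : ℕ} (hn : Module.finrank ℝ E = n + 1) {a v : E} (hv : v ≠ 0)
    {F T : Set E} (hF : MeasurableSet F) (hFfin : (μHE[n] : Measure E) F ≠ ⊤)
    (hFv : ∀ x ∈ F, inner ℝ v (x - a) = ‖v‖ ^ 2) (hT : MeasurableSet T)
    (hcone : ∀ x ∈ F, ∀ s ∈ Set.Ioc (1 / 2 : ℝ) 1, lineMap a x s ∈ T)
    {G : E → ℝ≥0∞} (hG : Measurable G) :
    ‖v‖ₑ * ∫⁻ s in Set.Ioc (1 / 2 : ℝ) 1, (∫⁻ x in F, G (lineMap a x s) ∂(μHE[n]))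
      ≤ 2 ^ n * ∫⁻ x in T, G x := by
  have : IsFiniteMeasure ((μHE[n] : Measure E).restrict F) := ⟨by simpa using hFfin.lt_top⟩
  set ν := (μHE[n] : Measure E).restrict F with hν
  have hΦ := measurable_lineMap_uncurry a
  set m : Measure E := ((volume.restrict (Set.Ioc (1 / 2 : ℝ) 1)).prod ν).map
    (fun z : ℝ × E => lineMap a z.2 z.1) with hm
  -- In cone coordinates `(s, x)` the slice of the cone at height `s` is the image of `F` under the
  -- homothety of ratio `s > 1/2`. Hence the product measure on each slice exceeds the surface
  -- measure by at most `s⁻¹ ^ n ≤ 2 ^ n`.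
  have hle : ‖v‖ₑ • m ≤ (2 ^ n : ℝ≥0∞) • (volume : Measure E).restrict T := by
    refine Measure.le_iff.2 fun S hS => ?_
    simp only [Measure.smul_apply, smul_eq_mul]
    rw [hm, Measure.map_apply hΦ hS, Measure.prod_apply (hΦ hS), Measure.restrict_apply hS,
      volume_eq_lintegral_slice hn a hv (hS.inter hT), mul_left_comm]
    gcongr
    rw [← lintegral_const_mul' _ _ (by simp)]
    refine (setLIntegral_mono' measurableSet_Ioc fun s hs => ?_).trans (setLIntegral_le_lintegral _ _)
    set K' := T ∩ {x | inner ℝ v (x - a) = s * ‖v‖ ^ 2}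
    have hK' : MeasurableSet K' := hT.inter (measurableSet_eq_fun (by fun_prop) (by fun_prop))
    have hs0 : 0 < s := by linarith [hs.1]
    have h1 := lintegral_lineMap_le n hF (measurable_one.indicator hS) hK' a hs0 (fun y hy =>
      ⟨hcone y hy s hs, by
        simp only [Set.mem_ofPred_eq]
        rw [← hFv y hy, AffineMap.lineMap_apply_module', add_sub_cancel_right, inner_smul_right]⟩)
    have h2 : ∫⁻ y in F, S.indicator 1 (lineMap a y s) ∂(μHE[n])
        = ν (Prod.mk s ⁻¹' ((fun z : ℝ × E => lineMap a z.2 z.1) ⁻¹' S)) := by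
      rw [← lintegral_indicator_one (measurable_prodMk_left (hΦ hS))]
      rfl
    rw [lintegral_indicator_one hS, Measure.restrict_apply hS, h2] at h1
    refine h1.trans ?_
    rw [Set.inter_assoc]
    gcongr
    rw [ENNReal.ofReal_pow (inv_nonneg.2 hs0.le)]
    gcongr
    refine (ENNReal.ofReal_le_ofReal (inv_anti₀ (by norm_num) hs.1.le)).trans ?_
    simp
  have h3 := lintegral_mono' hle (le_refl G)
  rw [lintegral_smul_measure, lintegral_smul_measure, hm, lintegral_map hG hΦ,
    lintegral_prod (fun z : ℝ × E => G (lineMap a z.2 z.1)) (hG.comp hΦ).aemeasurable] at h3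
  exact h3

theorem enorm_add_three_sq_le (x y z : ℝ) :
    ‖x + y + z‖ₑ ^ 2 ≤ 3 * (‖x‖ₑ ^ 2 + ‖y‖ₑ ^ 2 + ‖z‖ₑ ^ 2) := by
  have h : ∀ t : ℝ, ‖t‖ₑ ^ 2 = ENNReal.ofReal (t ^ 2) := fun t => by
    rw [← enorm_pow, Real.enorm_of_nonneg (sq_nonneg t)]
  rw [h, h, h, h, ← ENNReal.ofReal_add (by positivity) (by positivity),
    ← ENNReal.ofReal_add (by positivity) (by positivity), ← ENNReal.ofReal_ofNat 3,
    ← ENNReal.ofReal_mul (by norm_num)]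
  refine ENNReal.ofReal_le_ofReal ?_
  nlinarith [sq_nonneg (x - y), sq_nonneg (y - z), sq_nonneg (x - z)]

/-- Go from `w x` to `w y` through `u x` and `u y`, and use `(a + b + c)² ≤ 3 (a² + b² + c²)`. -/
theorem lintegral_enorm_sub_sq_le_of_close {α : Type*} [MeasurableSpace α] (ν : Measure α)
    [IsFiniteMeasure ν] {u w : α → ℝ} {A : α → ℝ≥0∞} (hu : Measurable u) (hA : Measurable A)
    (h : ∀ᵐ x ∂ν, ‖w x - u x‖ₑ ^ 2 ≤ A x) :
    ∫⁻ x, ∫⁻ y, ‖w x - w y‖ₑ ^ 2 ∂ν ∂ν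
      ≤ 3 * (2 * (ν Set.univ * ∫⁻ x, A x ∂ν) + ∫⁻ x, ∫⁻ y, ‖u x - u y‖ₑ ^ 2 ∂ν ∂ν) := by
  have hm : Measurable (fun z : α × α => ‖u z.1 - u z.2‖ₑ ^ 2) :=
    ((hu.comp measurable_fst).sub (hu.comp measurable_snd)).enorm.pow_const 2
  calc _ ≤ ∫⁻ x, ∫⁻ y, 3 * (A x + ‖u x - u y‖ₑ ^ 2 + A y) ∂ν ∂ν := by
        refine lintegral_mono_ae (h.mono fun x hx => lintegral_mono_ae (h.mono fun y hy => ?_))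
        have h1 := enorm_add_three_sq_le (w x - u x) (u x - u y) (u y - w y)
        rw [sub_add_sub_cancel, sub_add_sub_cancel, ← enorm_neg (u y - w y), neg_sub] at h1
        refine h1.trans ?_
        gcongr
    _ = ∫⁻ x, 3 * (A x * ν Set.univ + ∫⁻ y, ‖u x - u y‖ₑ ^ 2 ∂ν + ∫⁻ y, A y ∂ν) ∂ν := by
        refine lintegral_congr fun x => ?_
        rw [lintegral_const_mul' _ _ (by simp),
          lintegral_add_right _ hA, lintegral_add_left measurable_const, lintegral_const]
    _ = _ := by
        rw [lintegral_const_mul' _ _ (by simp),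
          lintegral_add_right _ measurable_const, lintegral_add_left (hA.mul_const _),
          lintegral_const, lintegral_mul_const _ hA]
        ring

theorem lineMap_lineMap_lineMap (a x y : E) (s t : ℝ) :
    lineMap (lineMap a x s) (lineMap a y s) t = lineMap a (lineMap x y t) s := by
  simp only [AffineMap.lineMap_apply_module]
  module

/-- The mean square difference of two boundary values is controlled by the gradient in a cone. -/
theorem lintegral_enorm_sub_sq_le_cone {n : ℕ} (hn : Module.finrank ℝ E = n + 1) {a v : E}
    (hv : v ≠ 0) {F T : Set E} (hF : MeasurableSet F) (hFc : Convex ℝ F)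
    (hFfin : (μHE[n] : Measure E) F ≠ ⊤)
    (hFv : ∀ x ∈ F, inner ℝ v (x - a) = ‖v‖ ^ 2) (hT : MeasurableSet T)
    (hcone : ∀ x ∈ F, ∀ s ∈ Set.Ioc (1 / 2 : ℝ) 1, lineMap a x s ∈ T)
    {D : ℝ} (haD : ∀ x ∈ F, ‖x - a‖ ≤ D) (hFD : ∀ x ∈ F, ∀ y ∈ F, ‖y - x‖ ≤ D)
    {w : E → ℝ} (hw : ContDiff ℝ 1 w) :
    ‖v‖ₑ * ∫⁻ x in F, ∫⁻ y in F, ‖w x - w y‖ₑ ^ 2 ∂(μHE[n]) ∂(μHE[n])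
      ≤ 12 * 2 ^ n * 2 ^ n * ENNReal.ofReal D ^ 2 * (μHE[n] : Measure E) F *
        ∫⁻ x in T, ‖gradient w x‖ₑ ^ 2 := by
  have : IsFiniteMeasure ((μHE[n] : Measure E).restrict F) := ⟨by simpa using hFfin.lt_top⟩
  set ν := (μHE[n] : Measure E).restrict F with hν
  have hνF : (μHE[n] : Measure E) F = ν Set.univ := by simp [hν]
  have hgc : Continuous (gradient w) :=
    (InnerProductSpace.toDual ℝ E).symm.continuous.comp (hw.continuous_fderiv (by simp))
  set g : E → ℝ≥0∞ := fun x => ‖gradient w x‖ₑ ^ 2 with hg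
  have hgm : Measurable g := hgc.enorm.measurable.pow_const 2
  have hgΦ : Measurable (fun z : ℝ × E => g (lineMap a z.2 z.1)) :=
    hgm.comp (measurable_lineMap_uncurry a)
  set A : E → ℝ≥0∞ := fun x => ∫⁻ σ in Set.Ioc (1 / 2 : ℝ) 1, g (lineMap a x σ) with hA
  set b : ℝ → ℝ≥0∞ := fun s => ∫⁻ x, g (lineMap a x s) ∂ν with hb
  have hAm : Measurable A := hgΦ.lintegral_prod_left'
  have hbm : Measurable b := hgΦ.lintegral_prod_right'
  have hAb : ∫⁻ x, A x ∂ν = ∫⁻ s in Set.Ioc (1 / 2 : ℝ) 1, b s :=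
    (lintegral_lintegral_swap hgΦ.aemeasurable).symm
  set δ := ENNReal.ofReal D ^ 2
  set I := ∫⁻ x, ∫⁻ y, ‖w x - w y‖ₑ ^ 2 ∂ν ∂ν
  have hwc : Continuous w := hw.continuous
  have hcl : ∀ s : ℝ, Measurable (fun x : E => w (lineMap a x s)) := fun s =>
    hwc.measurable.comp (measurable_lineMap_right a s)
  -- The vertical legs of the path: the ray from the apex to `x`, between depth `s` and the base.
  -- The next claim treats the horizontal leg at depth `s`.
  have hpath : ∀ x ∈ F, ∀ s ∈ Set.Ioc (1 / 2 : ℝ) 1,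
      ‖w x - w (lineMap a x s)‖ₑ ^ 2 ≤ δ * A x := by
    intro x hx s hs
    have h := enorm_sub_lineMap_sq_le hw ⊤ (a := a) (x := x) trivial (haD x hx) hs.2
      (by linarith [hs.1])
    simp only [AffineMap.lineMap_apply_one, Submodule.starProjection_top,
      ContinuousLinearMap.id_apply] at h
    refine h.trans ?_
    gcongr
    exact lintegral_mono_set (Set.Ioc_subset_Ioc_left hs.1.le)
  have hslice : ∀ s ∈ Set.Ioc (1 / 2 : ℝ) 1,
      ∫⁻ x, ∫⁻ y, ‖w (lineMap a x s) - w (lineMap a y s)‖ₑ ^ 2 ∂ν ∂ν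
        ≤ δ * (2 ^ n * ν Set.univ * b s) := by
    intro s hs
    rw [← hνF]
    refine lintegral_enorm_sub_sq_le n hF hFc hFfin (G := fun x => g (lineMap a x s))
      (f := fun x => w (lineMap a x s)) (hgm.comp (measurable_lineMap_right a s))
      fun x hx y hy => ?_
    have hD : ‖lineMap a y s - lineMap a x s‖ ≤ D := by
      simp only [AffineMap.lineMap_apply_module']
      rw [show s • (y - a) + a - (s • (x - a) + a) = s • (y - x) by module, norm_smul,
        Real.norm_of_nonneg (by linarith [hs.1])]
      exact (mul_le_of_le_one_left (norm_nonneg _) hs.2).trans (hFD x hx y hy)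
    have h := enorm_sub_lineMap_sq_le hw ⊤ (a := lineMap a x s) (x := lineMap a y s) trivial hD
      zero_le_one (by norm_num)
    simp only [AffineMap.lineMap_apply_one, AffineMap.lineMap_apply_zero,
      Submodule.starProjection_top, ContinuousLinearMap.id_apply] at h
    rw [← enorm_neg, neg_sub]
    refine h.trans_eq ?_
    congr 1
    refine lintegral_congr fun t => ?_
    rw [lineMap_lineMap_lineMap]
  have hI : ∀ s ∈ Set.Ioc (1 / 2 : ℝ) 1,
      I ≤ 3 * (2 * (ν Set.univ * (δ * ∫⁻ x, A x ∂ν)) + δ * (2 ^ n * ν Set.univ * b s)) := by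
    intro s hs
    have h := lintegral_enorm_sub_sq_le_of_close ν (hcl s) (hAm.const_mul δ)
      ((ae_restrict_iff' hF).2 (.of_forall fun x hx => hpath x hx s hs))
    rw [lintegral_const_mul _ hAm] at h
    exact h.trans (by gcongr; exact hslice s hs)
  have hhalf : (volume.restrict (Set.Ioc (1 / 2 : ℝ) 1)) Set.univ = 2⁻¹ := by
    rw [Measure.restrict_apply_univ, Real.volume_Ioc,
      show (1 : ℝ) - 1 / 2 = 2⁻¹ by norm_num, ENNReal.ofReal_inv_of_pos (by norm_num)]
    simp
  set B := ∫⁻ s in Set.Ioc (1 / 2 : ℝ) 1, b s with hB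
  -- A slice at a single depth is not controlled by a volume integral, so average over `s ∈ (1/2,
  -- 1]`. The left side is constant in `s`, and the interval has length `1/2`.
  have hint : I * 2⁻¹ ≤ 3 * (2 * (ν Set.univ * (δ * B)) * 2⁻¹ + δ * (2 ^ n * ν Set.univ * B)) := by
    have h := setLIntegral_mono' (μ := volume) measurableSet_Ioc hI
    rw [lintegral_const, hhalf, lintegral_const_mul' _ _ (by simp),
      lintegral_add_left measurable_const,
      lintegral_const, hhalf, lintegral_const_mul _ (hbm.const_mul _), lintegral_const_mul _ hbm,
      hAb] at h
    exact h
  have h22 : (2 : ℝ≥0∞) * 2⁻¹ = 1 := ENNReal.mul_inv_cancel (by simp) (by simp)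
  have hI2 : I ≤ 12 * 2 ^ n * δ * ν Set.univ * B := by
    calc I = 2 * (I * 2⁻¹) := by rw [mul_left_comm, h22, mul_one]
      _ ≤ 2 * (3 * (2 * (ν Set.univ * (δ * B)) * 2⁻¹ + δ * (2 ^ n * ν Set.univ * B))) := by gcongr
      _ = 6 * ((2 * 2⁻¹) * (ν Set.univ * (δ * B))) + 6 * 2 ^ n * (ν Set.univ * (δ * B)) := by ring
      _ ≤ 6 * 2 ^ n * (ν Set.univ * (δ * B)) + 6 * 2 ^ n * (ν Set.univ * (δ * B)) := by
          rw [h22, one_mul]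
          gcongr
          exact le_mul_of_one_le_right' (one_le_pow₀ (by norm_num))
      _ = _ := by ring
  calc ‖v‖ₑ * I ≤ ‖v‖ₑ * (12 * 2 ^ n * δ * ν Set.univ * B) := by gcongr
    _ = 12 * 2 ^ n * δ * ν Set.univ * (‖v‖ₑ * B) := by ring
    _ ≤ 12 * 2 ^ n * δ * ν Set.univ * (2 ^ n * ∫⁻ x in T, g x) := by
        refine mul_le_mul' le_rfl ?_
        exact lintegral_cone_le hn hv hF hFfin hFv hT hcone hgm
    _ = _ := by rw [hνF]; ring

end

/-! ### From mean square differences to the distance from constants -/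

theorem sq_eLpNorm_two {α F : Type*} [MeasurableSpace α] [NormedAddCommGroup F] (μ : Measure α)
    (f : α → F) : eLpNorm f 2 μ ^ 2 = ∫⁻ x, ‖f x‖ₑ ^ 2 ∂μ := by
  have h := eLpNorm_nnreal_pow_eq_lintegral (f := f) (μ := μ) (p := 2) two_ne_zero
  simpa using h

theorem le_of_sq_le_sq_ennreal {a b : ℝ≥0∞} (h : a ^ 2 ≤ b ^ 2) : a ≤ b :=
  (ENNReal.pow_right_strictMono two_ne_zero).le_iff_le.1 h

/-- For mean zero the cross term vanishes in `∫ (v - c)² = ∫ v² + ∫ c²`. -/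
theorem eLpNorm_le_eLpNorm_sub_const {α : Type*} [MeasurableSpace α] {ν : Measure α}
    [IsFiniteMeasure ν] {v : α → ℝ} (hv : MemLp v 2 ν) (h0 : ∫ x, v x ∂ν = 0) (c : ℝ) :
    eLpNorm v 2 ν ≤ eLpNorm (fun x => v x - c) 2 ν := by
  refine le_of_sq_le_sq_ennreal ?_
  have h : ∀ t : ℝ, ‖t‖ₑ ^ 2 = ENNReal.ofReal (t ^ 2) := fun t => by
    rw [← enorm_pow, Real.enorm_of_nonneg (sq_nonneg t)]
  have hi : Integrable v ν := hv.integrable (by norm_num)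
  have hvc : MemLp (fun x => v x - c) 2 ν := hv.sub (memLp_const c)
  rw [sq_eLpNorm_two, sq_eLpNorm_two]
  simp_rw [h]
  rw [← ofReal_integral_eq_lintegral_ofReal hv.integrable_sq (.of_forall fun _ => sq_nonneg _),
    ← ofReal_integral_eq_lintegral_ofReal hvc.integrable_sq (.of_forall fun _ => sq_nonneg _)]
  refine ENNReal.ofReal_le_ofReal ?_
  have h1 : ∫ x, (v x - c) ^ 2 ∂ν = ∫ x, v x ^ 2 ∂ν + ∫ x, c ^ 2 ∂ν := by
    have h2 : ∀ x, (v x - c) ^ 2 = (v x ^ 2 - 2 * c * v x) + c ^ 2 := fun x => by ring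
    simp_rw [h2]
    have h3 : Integrable (fun x => v x ^ 2 - 2 * c * v x) ν :=
      hv.integrable_sq.sub (hi.const_mul (2 * c))
    rw [integral_add h3 (integrable_const _), integral_sub hv.integrable_sq (hi.const_mul (2 * c)),
      integral_const_mul, h0]
    ring
  rw [h1]
  exact le_add_of_nonneg_right (integral_nonneg fun _ => sq_nonneg _)

/-- A function with small mean square differences is close to one of its values. -/
theorem exists_const_eLpNorm_sub_le {α : Type*} [MeasurableSpace α] {ν : Measure α}
    [IsFiniteMeasure ν] {f : α → ℝ} (hf : Measurable f) {B : ℝ≥0∞}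
    (h : ∫⁻ x, ∫⁻ y, ‖f x - f y‖ₑ ^ 2 ∂ν ∂ν ≤ ν Set.univ * B ^ 2) :
    ∃ c, eLpNorm (fun x => f x - c) 2 ν ≤ B := by
  rcases eq_or_ne ν 0 with rfl | hν
  · exact ⟨0, by simp⟩
  have hm : Measurable (fun z : α × α => ‖f z.1 - f z.2‖ₑ ^ 2) :=
    ((hf.comp measurable_fst).sub (hf.comp measurable_snd)).enorm.pow_const 2
  -- The constant is a value `f x` at a point where the inner integral does not exceed its average.
  obtain ⟨x, hx⟩ := exists_le_laverage hν
    (hm.lintegral_prod_right' (ν := ν)).aemeasurable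
  refine ⟨f x, le_of_sq_le_sq_ennreal ?_⟩
  rw [sq_eLpNorm_two]
  have h0 : ν Set.univ ≠ 0 := by simpa using hν
  calc ∫⁻ y, ‖f y - f x‖ₑ ^ 2 ∂ν = ∫⁻ y, ‖f x - f y‖ₑ ^ 2 ∂ν := by
        refine lintegral_congr fun y => ?_
        rw [← enorm_neg, neg_sub]
    _ ≤ (∫⁻ x, ∫⁻ y, ‖f x - f y‖ₑ ^ 2 ∂ν ∂ν) / ν Set.univ := by
        rw [← laverage_eq]; exact hx
    _ ≤ ν Set.univ * B ^ 2 / ν Set.univ := by gcongr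
    _ = B ^ 2 := by
        rw [mul_comm, ENNReal.mul_div_cancel_right h0 (measure_ne_top _ _)]

section

set_option linter.unusedSectionVars false

variable {E : Type*} [NormedAddCommGroup E] [InnerProductSpace ℝ E] [FiniteDimensional ℝ E]
  [MeasurableSpace E] [BorelSpace E]

/-- The Poincaré inequality for smooth functions on a convex part of a plane. -/
theorem exists_const_eLpNorm_sub_le_gradient (n : ℕ) {K : Set E} (hK : MeasurableSet K)
    (hKc : Convex ℝ K) (hfin : (μHE[n] : Measure E) K ≠ ⊤) {V : Submodule ℝ E}
    (hV : ∀ x ∈ K, ∀ y ∈ K, y - x ∈ V) {D : ℝ} (hD : ∀ x ∈ K, ∀ y ∈ K, ‖y - x‖ ≤ D)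
    {f : E → ℝ} (hf : ContDiff ℝ 1 f) :
    ∃ c, eLpNorm (fun x => f x - c) 2 ((μHE[n] : Measure E).restrict K)
      ≤ 2 ^ n * ENNReal.ofReal D *
        eLpNorm (fun x => V.starProjection (gradient f x)) 2 ((μHE[n] : Measure E).restrict K) := by
  have : IsFiniteMeasure ((μHE[n] : Measure E).restrict K) := ⟨by simpa using hfin.lt_top⟩
  have hgc : Continuous (gradient f) :=
    (InnerProductSpace.toDual ℝ E).symm.continuous.comp (hf.continuous_fderiv (by simp))
  have hG : Measurable (fun x => ‖V.starProjection (gradient f x)‖ₑ ^ 2) :=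
    (V.starProjection.continuous.comp hgc).enorm.measurable.pow_const 2
  refine exists_const_eLpNorm_sub_le hf.continuous.measurable ?_
  refine (lintegral_enorm_sub_sq_le n hK hKc hfin hG (c := ENNReal.ofReal D ^ 2)
    fun x hx y hy => ?_).trans ?_
  · have h := enorm_sub_lineMap_sq_le hf V (hV x hx y hy) (hD x hx y hy) zero_le_one (by norm_num)
    rw [AffineMap.lineMap_apply_one, AffineMap.lineMap_apply_zero, ← enorm_neg, neg_sub] at h
    exact h
  · rw [mul_pow, mul_pow, sq_eLpNorm_two, Measure.restrict_apply_univ]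
    calc _ = μHE[n] K * (2 ^ n * ENNReal.ofReal D ^ 2 *
          ∫⁻ y in K, ‖V.starProjection (gradient f y)‖ₑ ^ 2 ∂(μHE[n])) := by ring
      _ ≤ _ := by
        -- The square root of `2 ^ n` would suffice; the larger `2 ^ n` avoids it.
        have h2 : (2 : ℝ≥0∞) ^ n ≤ (2 ^ n) ^ 2 :=
          le_self_pow₀ (one_le_pow₀ (by norm_num)) two_ne_zero
        gcongr

/-- The Poincaré inequality between the base and the interior of a cone. -/
theorem exists_const_eLpNorm_sub_le_cone {n : ℕ} (hn : Module.finrank ℝ E = n + 1) {a v : E}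
    (hv : v ≠ 0) {F T : Set E} (hF : MeasurableSet F) (hFc : Convex ℝ F)
    (hFfin : (μHE[n] : Measure E) F ≠ ⊤)
    (hFv : ∀ x ∈ F, inner ℝ v (x - a) = ‖v‖ ^ 2) (hT : MeasurableSet T)
    (hcone : ∀ x ∈ F, ∀ s ∈ Set.Ioc (1 / 2 : ℝ) 1, lineMap a x s ∈ T)
    {D : ℝ} (haD : ∀ x ∈ F, ‖x - a‖ ≤ D) (hFD : ∀ x ∈ F, ∀ y ∈ F, ‖y - x‖ ≤ D)
    {w : E → ℝ} (hw : ContDiff ℝ 1 w) :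
    ∃ c, eLpNorm (fun x => w x - c) 2 ((μHE[n] : Measure E).restrict F)
      ≤ 12 * 2 ^ n * 2 ^ n * ENNReal.ofReal D * ENNReal.ofReal (√‖v‖)⁻¹ *
        eLpNorm (gradient w) 2 (volume.restrict T) := by
  have : IsFiniteMeasure ((μHE[n] : Measure E).restrict F) := ⟨by simpa using hFfin.lt_top⟩
  have hv0 : 0 < ‖v‖ := norm_pos_iff.2 hv
  refine exists_const_eLpNorm_sub_le hw.continuous.measurable ?_
  have h := lintegral_enorm_sub_sq_le_cone hn hv hF hFc hFfin hFv hT hcone haD hFD hw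
  have hsq : ENNReal.ofReal (√‖v‖)⁻¹ ^ 2 = ‖v‖ₑ⁻¹ := by
    rw [← ENNReal.ofReal_pow (by positivity), inv_pow, Real.sq_sqrt hv0.le,
      ENNReal.ofReal_inv_of_pos hv0, ofReal_norm]
  rw [mul_pow, mul_pow, mul_pow, hsq, sq_eLpNorm_two, Measure.restrict_apply_univ]
  have hv1 : ‖v‖ₑ ≠ 0 := by simpa using hv
  calc _ ≤ ‖v‖ₑ⁻¹ * (‖v‖ₑ * ∫⁻ x in F, ∫⁻ y in F, ‖w x - w y‖ₑ ^ 2 ∂(μHE[n]) ∂(μHE[n])) := by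
        rw [← mul_assoc, ENNReal.inv_mul_cancel hv1 (by simp), one_mul]
    _ ≤ ‖v‖ₑ⁻¹ * (12 * 2 ^ n * 2 ^ n * ENNReal.ofReal D ^ 2 * μHE[n] F
          * ∫⁻ x in T, ‖gradient w x‖ₑ ^ 2) := by gcongr
    _ = μHE[n] F * (12 * 2 ^ n * 2 ^ n * ENNReal.ofReal D ^ 2 * ‖v‖ₑ⁻¹
          * ∫⁻ x in T, ‖gradient w x‖ₑ ^ 2) := by ring
    _ ≤ _ := by
        gcongr
        refine le_self_pow₀ ?_ two_ne_zero
        rw [mul_assoc, ← pow_add]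
        calc (1 : ℝ≥0∞) ≤ 2 ^ (n + n) := one_le_pow₀ (by norm_num)
          _ ≤ _ := le_mul_of_one_le_left' (by norm_num)

/-- A Poincaré-type inequality for a sum of a limit of smooth functions and a further function. -/
theorem eLpNorm_le_of_tendsto (n : ℕ) {K : Set E} (hK : MeasurableSet K)
    (hKc : Convex ℝ K) (hfin : (μHE[n] : Measure E) K ≠ ⊤) {V : Submodule ℝ E}
    (hV : ∀ x ∈ K, ∀ y ∈ K, y - x ∈ V) {D : ℝ} (hD : ∀ x ∈ K, ∀ y ∈ K, ‖y - x‖ ≤ D)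
    {v r u : E → ℝ} {p : E → E} {f : ℕ → E → ℝ} (hf : ∀ k, ContDiff ℝ 1 (f k))
    (hr : AEStronglyMeasurable r ((μHE[n] : Measure E).restrict K))
    (hu : AEStronglyMeasurable u ((μHE[n] : Measure E).restrict K))
    (hp : AEStronglyMeasurable p ((μHE[n] : Measure E).restrict K))
    (hfr : Tendsto (fun k => eLpNorm (f k - r) 2 ((μHE[n] : Measure E).restrict K)) atTop (𝓝 0))
    (hfp : Tendsto (fun k => eLpNorm (fun x => V.starProjection (gradient (f k) x) - p x) 2
      ((μHE[n] : Measure E).restrict K)) atTop (𝓝 0))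
    (hv : ∀ c, eLpNorm v 2 ((μHE[n] : Measure E).restrict K)
      ≤ eLpNorm (fun x => v x - c) 2 ((μHE[n] : Measure E).restrict K))
    (hvr : v =ᵐ[(μHE[n] : Measure E).restrict K] r + u) {b : ℝ≥0∞}
    (hub : ∃ c, eLpNorm (fun x => u x - c) 2 ((μHE[n] : Measure E).restrict K) ≤ b) :
    eLpNorm v 2 ((μHE[n] : Measure E).restrict K) ≤
      2 ^ n * ENNReal.ofReal D * eLpNorm p 2 ((μHE[n] : Measure E).restrict K) + b := by
  set ν := (μHE[n] : Measure E).restrict K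
  obtain ⟨c₂, hc₂⟩ := hub
  have hfin2 : (2 ^ n * ENNReal.ofReal D : ℝ≥0∞) ≠ ⊤ := by finiteness
  have key : ∀ k, eLpNorm v 2 ν ≤ eLpNorm (f k - r) 2 ν + 2 ^ n * ENNReal.ofReal D *
      (eLpNorm (fun x => V.starProjection (gradient (f k) x) - p x) 2 ν + eLpNorm p 2 ν) + b := by
    intro k
    obtain ⟨c₁, hc₁⟩ := exists_const_eLpNorm_sub_le_gradient n hK hKc hfin hV hD (hf k)
    have hfm : AEStronglyMeasurable (f k) ν := (hf k).continuous.aestronglyMeasurable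
    have hgm : AEStronglyMeasurable (fun x => V.starProjection (gradient (f k) x)) ν :=
      (V.starProjection.continuous.comp ((InnerProductSpace.toDual ℝ E).symm.continuous.comp
        ((hf k).continuous_fderiv (by simp)))).aestronglyMeasurable
    have h1 : eLpNorm (fun x => V.starProjection (gradient (f k) x)) 2 ν
        ≤ eLpNorm (fun x => V.starProjection (gradient (f k) x) - p x) 2 ν + eLpNorm p 2 ν := by
      refine le_trans (le_of_eq ?_) (eLpNorm_add_le (hgm.sub hp) hp (by norm_num))
      congr 1
      ext1 x
      simp
    have h2 : eLpNorm (fun x => v x - (c₁ + c₂)) 2 ν ≤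
        eLpNorm (r - f k) 2 ν + eLpNorm (fun x => f k x - c₁) 2 ν
          + eLpNorm (fun x => u x - c₂) 2 ν := by
      have h3 : (fun x => v x - (c₁ + c₂)) =ᵐ[ν]
          ((r - f k) + (fun x => f k x - c₁)) + fun x => u x - c₂ := by
        filter_upwards [hvr] with x hx
        simp only [hx, Pi.add_apply, Pi.sub_apply]
        ring
      rw [eLpNorm_congr_ae h3]
      refine (eLpNorm_add_le ((hr.sub hfm).add (hfm.sub aestronglyMeasurable_const))
        (hu.sub aestronglyMeasurable_const) (by norm_num)).trans ?_
      refine add_le_add ?_ le_rfl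
      exact eLpNorm_add_le (hr.sub hfm) (hfm.sub aestronglyMeasurable_const) (by norm_num)
    -- The constant `c₁` varies with `k`. Since `hv` holds for every constant, it disappears before
    -- the limit `k → ∞` is taken.
    refine (hv _).trans (h2.trans ?_)
    rw [eLpNorm_sub_comm]
    gcongr
    exact hc₁.trans (by gcongr)
  have h4 := (hfr.add (ENNReal.Tendsto.const_mul (hfp.add_const (eLpNorm p 2 ν))
    (.inr hfin2))).add_const b
  rw [zero_add, zero_add] at h4
  exact ge_of_tendsto' h4 key

end

/-! ### Simplices -/

theorem exists_affineBasis {d : ℕ} {T : Finset (Pt d)} (hc : T.card = d + 1)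
    (hi : AffineIndependent ℝ ((↑) : T → Pt d)) :
    ∃ b : AffineBasis T ℝ (Pt d), ∀ i, b i = i := by
  have h : affineSpan ℝ (Set.range ((↑) : T → Pt d)) = ⊤ := by
    rw [hi.affineSpan_eq_top_iff_card_eq_finrank_add_one]
    simp [hc]
  exact ⟨⟨_, hi, h⟩, fun i => rfl⟩

theorem isCompact_hull {d : ℕ} (T : Finset (Pt d)) : IsCompact (hull T) :=
  T.finite_toSet.isCompact_convexHull (𝕜 := ℝ)

theorem isClosed_hull {d : ℕ} (T : Finset (Pt d)) : IsClosed (hull T) := (isCompact_hull T).isClosed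

theorem measurableSet_hull {d : ℕ} (T : Finset (Pt d)) : MeasurableSet (hull T) :=
  (isClosed_hull T).measurableSet

theorem convex_hull {d : ℕ} (T : Finset (Pt d)) : Convex ℝ (hull T) := convex_convexHull ℝ _

theorem hull_mono {d : ℕ} {S T : Finset (Pt d)} (h : S ⊆ T) : hull S ⊆ hull T :=
  convexHull_mono (by exact_mod_cast h)

theorem subset_hull {d : ℕ} {T : Finset (Pt d)} {x : Pt d} (h : x ∈ T) : x ∈ hull T :=
  subset_convexHull ℝ _ (by exact_mod_cast h)

theorem coord_lineMap {d : ℕ} {T : Finset (Pt d)} (b : AffineBasis T ℝ (Pt d)) (i : T)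
    (x y : Pt d) (t : ℝ) :
    b.coord i (lineMap x y t) = (1 - t) * b.coord i x + t * b.coord i y := by
  rw [AffineMap.apply_lineMap, AffineMap.lineMap_apply_module]
  simp

/-- The faces of a simplex in barycentric coordinates. -/
theorem mem_hull_iff_coord {d : ℕ} {T : Finset (Pt d)} (b : AffineBasis T ℝ (Pt d))
    (hb : ∀ i, b i = i) {S : Finset (Pt d)} (hS : S ⊆ T) (x : Pt d) :
    x ∈ hull S ↔ ∀ i : T, 0 ≤ b.coord i x ∧ ((i : Pt d) ∉ S → b.coord i x = 0) := by
  classical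
  constructor
  · have hconv : Convex ℝ {x | ∀ i : T, 0 ≤ b.coord i x ∧ ((i : Pt d) ∉ S → b.coord i x = 0)} := by
      intro y hy z hz s t hs ht hst i
      have h1 : b.coord i (s • y + t • z) = s * b.coord i y + t * b.coord i z := by
        rw [Convex.combo_affine_apply hst]; simp
      rw [h1]
      refine ⟨add_nonneg (mul_nonneg hs (hy i).1) (mul_nonneg ht (hz i).1), fun hi => ?_⟩
      rw [(hy i).2 hi, (hz i).2 hi]
      simp
    intro hx
    refine convexHull_min ?_ hconv hx
    intro y hy i
    have h1 : y = b ⟨y, hS hy⟩ := (hb ⟨y, hS hy⟩).symm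
    rw [h1, b.coord_apply]
    refine ⟨by split_ifs <;> norm_num, fun hi => if_neg fun h => hi ?_⟩
    rw [h]
    exact hy
  · intro h
    rw [← b.linear_combination_coord_eq_self x]
    have h0 : ∑ i, b.coord i x • b i = ∑ i ∈ Finset.univ.filter (fun i : T => (i : Pt d) ∈ S), b.coord i x • b i := by
      refine (Finset.sum_filter_of_ne fun i _ hne => ?_).symm
      by_contra hi
      exact hne (by rw [(h i).2 hi, zero_smul])
    have h1 : ∑ i ∈ Finset.univ.filter (fun i : T => (i : Pt d) ∈ S), b.coord i x = 1 := by
      rw [← b.sum_coord_apply_eq_one x]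
      refine Finset.sum_filter_of_ne fun i _ hne => ?_
      by_contra hi
      exact hne ((h i).2 hi)
    rw [h0]
    refine (convex_hull S).sum_mem (fun i _ => (h i).1) h1 fun i hi => ?_
    rw [hb]
    exact subset_hull (Finset.mem_filter.1 hi).2

theorem interior_hull {d : ℕ} {T : Finset (Pt d)} (b : AffineBasis T ℝ (Pt d))
    (hb : ∀ i, b i = i) : interior (hull T) = {x | ∀ i, 0 < b.coord i x} := by
  have h : Set.range b = T := by
    ext x
    simp [hb]
  rw [← b.interior_convexHull, h]
  rfl

open scoped Classical in
theorem mem_hull_erase_of_notMem_interior {d : ℕ} {T : Finset (Pt d)} (b : AffineBasis T ℝ (Pt d))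
    (hb : ∀ i, b i = i) {x : Pt d} (hx : x ∈ hull T) (hx' : x ∉ interior (hull T)) :
    ∃ a ∈ T, x ∈ hull (T.erase a) := by
  rw [interior_hull b hb, Set.mem_ofPred_eq] at hx'
  push Not at hx'
  obtain ⟨a, ha⟩ := hx'
  rw [mem_hull_iff_coord b hb subset_rfl] at hx
  refine ⟨a, a.2, ?_⟩
  rw [mem_hull_iff_coord b hb (Finset.erase_subset _ _)]
  refine fun i => ⟨(hx i).1, fun hi => ?_⟩
  have h1 : i = a := by
    by_contra h
    exact hi (Finset.mem_erase.2 ⟨fun h' => h (Subtype.ext h'), i.2⟩)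
  rw [h1]
  exact le_antisymm ha (hx a).1

open scoped Classical in
theorem hull_erase_subset_frontier {d : ℕ} {T : Finset (Pt d)} (b : AffineBasis T ℝ (Pt d))
    (hb : ∀ i, b i = i) {a : Pt d} (ha : a ∈ T) : hull (T.erase a) ⊆ frontier (hull T) := by
  intro x hx
  rw [frontier, (isClosed_hull T).closure_eq]
  refine ⟨hull_mono (Finset.erase_subset _ _) hx, fun h => ?_⟩
  rw [interior_hull b hb] at h
  rw [mem_hull_iff_coord b hb (Finset.erase_subset _ _)] at hx
  have h1 := (hx ⟨a, ha⟩).2 (by simp)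
  have h2 := h ⟨a, ha⟩
  rw [h1] at h2
  exact lt_irrefl _ h2

/-- The points of a simplex that lie on none of its proper faces. -/
def core {d : ℕ} (F : Finset (Pt d)) : Set (Pt d) :=
  open scoped Classical in {x | x ∈ hull F ∧ ∀ z ∈ F, x ∉ hull (F.erase z)}

open scoped Classical in
theorem mem_core_erase_iff {d : ℕ} {T : Finset (Pt d)} (b : AffineBasis T ℝ (Pt d))
    (hb : ∀ i, b i = i) (a : T) (x : Pt d) :
    x ∈ core (T.erase (a : Pt d)) ↔ b.coord a x = 0 ∧ ∀ i, i ≠ a → 0 < b.coord i x := by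
  have hsub : ∀ z : Pt d, (T.erase (a : Pt d)).erase z ⊆ T := fun z =>
    (Finset.erase_subset _ _).trans (Finset.erase_subset _ _)
  rw [core, Set.mem_ofPred_eq, mem_hull_iff_coord b hb (Finset.erase_subset _ _)]
  constructor
  · rintro ⟨h1, h2⟩
    refine ⟨(h1 a).2 (by simp), fun i hi => (h1 i).1.lt_of_ne fun h0 => ?_⟩
    refine h2 i (Finset.mem_erase.2 ⟨fun h => hi (Subtype.ext h), i.2⟩) ?_
    rw [mem_hull_iff_coord b hb (hsub _)]
    refine fun j => ⟨(h1 j).1, fun hj => ?_⟩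
    rcases eq_or_ne j i with rfl | hji
    · exact h0.symm
    · refine (h1 j).2 fun hj' => hj (Finset.mem_erase.2 ⟨fun h => hji (Subtype.ext h), hj'⟩)
  · rintro ⟨h1, h2⟩
    refine ⟨fun i => ⟨?_, fun hi => ?_⟩, fun z hz hx => ?_⟩
    · rcases eq_or_ne i a with rfl | h
      · exact h1.ge
      · exact (h2 i h).le
    · have : i = a := by
        by_contra h
        exact hi (Finset.mem_erase.2 ⟨fun h' => h (Subtype.ext h'), i.2⟩)
      rw [this, h1]
    · obtain ⟨hza, hzT⟩ := Finset.mem_erase.1 hz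
      rw [mem_hull_iff_coord b hb (hsub _)] at hx
      have h3 := (hx ⟨z, hzT⟩).2 (by simp)
      have h4 := h2 ⟨z, hzT⟩ fun h => hza (congrArg Subtype.val h)
      rw [h3] at h4
      exact lt_irrefl _ h4

open scoped Classical in
theorem exists_erase_eq {d : ℕ} {T F : Finset (Pt d)} (hT : T.card = d + 1)
    (hF : F ∈ T.powersetCard d) : ∃ a ∈ T, F = T.erase a := by
  obtain ⟨hFT, hFc⟩ := Finset.mem_powersetCard.1 hF
  have h1 : (T \ F).card = 1 := by
    rw [Finset.card_sdiff_of_subset hFT]; omega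
  obtain ⟨a, ha⟩ := Finset.card_eq_one.1 h1
  have ha' : a ∈ T \ F := by simp [ha]
  refine ⟨a, (Finset.mem_sdiff.1 ha').1, ?_⟩
  rw [Finset.erase_eq, ← ha, Finset.sdiff_sdiff_eq_self hFT]

/-- A normal vector of a facet whose length is the height of the opposite vertex. -/
theorem exists_height {d : ℕ} {T : Finset (Pt d)} (b : AffineBasis T ℝ (Pt d))
    (hb : ∀ i, b i = i) (hT : 2 ≤ T.card) (a : T) :
    ∃ v : Pt d, v ≠ 0 ∧ ∀ x, inner ℝ v (x - a) = (1 - b.coord a x) * ‖v‖ ^ 2 := by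
  set ℓ : Pt d →L[ℝ] ℝ := LinearMap.toContinuousLinearMap (b.coord a).linear
  set g := (InnerProductSpace.toDual ℝ (Pt d)).symm ℓ with hg
  have hgi : ∀ x : Pt d, inner ℝ g (x - a) = b.coord a x - 1 := by
    intro x
    rw [hg, InnerProductSpace.toDual_symm_apply]
    have h1 : b.coord a a = 1 := by rw [← hb a, b.coord_apply_eq]
    have h2 := (b.coord a).linearMap_vsub x (a : Pt d)
    rw [h1] at h2
    exact h2
  have hg0 : g ≠ 0 := by
    intro h0
    obtain ⟨c, hc, hca⟩ := Finset.exists_mem_ne hT (a : Pt d)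
    have h1 := hgi c
    have h2 : b.coord a c = 0 := by
      have h3 := b.coord_apply_ne (i := a) (j := ⟨c, hc⟩)
        fun h => hca (congrArg Subtype.val h).symm
      rwa [hb] at h3
    rw [h0, h2, inner_zero_left] at h1
    norm_num at h1
  have hn : ‖g‖ ≠ 0 := norm_ne_zero_iff.2 hg0
  -- The gradient `g` of the barycentric coordinate of `a` points from the facet towards `a` and has
  -- length one over the height. Inversion and a change of sign give the vector from `a`
  -- perpendicularly to the plane of the facet.
  refine ⟨(-(‖g‖ ^ 2)⁻¹) • g, smul_ne_zero (by simpa using hn) hg0, fun x => ?_⟩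
  rw [inner_smul_left, hgi, norm_smul]
  simp only [norm_neg, norm_inv, norm_pow, norm_norm, map_neg, map_inv₀, map_pow, RCLike.conj_to_real]
  field_simp
  ring

open scoped Classical in
/-- Sets of at most `d - 1` points span simplices without surface measure. -/
theorem surf_hull_eq_zero {d : ℕ} {S : Finset (Pt d)} (hS : S.card < d) : surf d (hull S) = 0 := by
  rcases S.eq_empty_or_nonempty with rfl | hne
  · simp [hull]
  obtain ⟨x₀, hx₀⟩ := hne
  set V := vectorSpan ℝ (S : Set (Pt d)) with hV
  have hrank : Module.finrank ℝ V ≤ S.card - 1 := by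
    have h := finrank_vectorSpan_image_finset_le ℝ (id : Pt d → Pt d) S (n := S.card - 1)
      (by have := Finset.card_pos.2 ⟨x₀, hx₀⟩; omega)
    rwa [Finset.image_id] at h
  have hsub : hull S ⊆ Set.range (fun u : V => (u : Pt d) + x₀) := by
    intro x hx
    have h1 : x ∈ affineSpan ℝ (S : Set (Pt d)) := convexHull_subset_affineSpan _ hx
    have h2 := AffineSubspace.vsub_mem_direction h1 (subset_affineSpan ℝ _ hx₀)
    rw [direction_affineSpan] at h2
    exact ⟨⟨x - x₀, h2⟩, by simp⟩
  -- The hull lies in a translate of `V`, of dimension at most `S.card - 1 < d - 1`.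
  have hdim : dimH (hull S) < ((d - 1 : ℕ) : ℝ≥0) := by
    refine (dimH_mono hsub).trans_lt ?_
    refine (ContDiff.dimH_range_le (V.subtypeL.contDiff.add contDiff_const)).trans_lt ?_
    have : Module.finrank ℝ V < d - 1 := by
      have := Finset.card_pos.2 ⟨x₀, hx₀⟩; omega
    exact_mod_cast this
  have h := hausdorffMeasure_of_dimH_lt hdim
  rw [surf, Measure.euclideanHausdorffMeasure_def, Measure.smul_apply]
  rw [NNReal.coe_natCast] at h
  rw [h, smul_zero]

/-! ### Domains -/

/-- A frontier point `x` outside `Ω` is on or below the graph, so `x - t ν` with small `t > 0` lies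
strictly below it and has a neighbourhood disjoint from `Ω`. Thus `Ω` has no slits, which
`mem_frontier_of_hyperplane` needs. -/
theorem IsBoundedLipschitz.interior_closure_subset {d : ℕ} {Ω : Set (Pt d)}
    (h : IsBoundedLipschitz Ω) : interior (closure Ω) ⊆ Ω := by
  intro x hx
  by_contra hxΩ
  have hfr : x ∈ frontier Ω := by
    rw [h.isOpen.frontier_eq]
    exact ⟨interior_subset hx, hxΩ⟩
  obtain ⟨ν, γ, L, r, hν, hγ, hr, hgraph⟩ := h.graph x hfr
  have hνν : inner ℝ ν ν = (1 : ℝ) := by rw [real_inner_self_eq_norm_sq, hν]; norm_num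
  have hxγ : inner ℝ x ν ≤ γ (x - inner ℝ x ν • ν) := by
    by_contra hlt
    exact hxΩ ((hgraph x (Metric.mem_ball_self hr)).2 (not_le.1 hlt))
  have hball : interior (closure Ω) ∩ Metric.ball x r ∈ 𝓝 x :=
    inter_mem (isOpen_interior.mem_nhds hx) (Metric.ball_mem_nhds x hr)
  have hline : Tendsto (fun t : ℝ => x - t • ν) (𝓝[>] 0) (𝓝 x) := by
    have h1 : Continuous (fun t : ℝ => x - t • ν) := by fun_prop
    have h2 := h1.tendsto 0
    simp only [zero_smul, sub_zero] at h2
    exact h2.mono_left nhdsWithin_le_nhds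
  obtain ⟨t, ht, ht0⟩ := ((hline.eventually hball).and self_mem_nhdsWithin).exists
  set y := x - t • ν with hy
  have hU : {z | inner ℝ z ν < γ (z - inner ℝ z ν • ν)} ∩ Metric.ball x r ∈ 𝓝 y := by
    refine inter_mem (IsOpen.mem_nhds ?_ ?_) (Metric.isOpen_ball.mem_nhds ht.2)
    · exact isOpen_lt (by fun_prop) (hγ.continuous.comp (by fun_prop))
    · have h1 : inner ℝ y ν = inner ℝ x ν - t := by
        rw [hy, inner_sub_left, inner_smul_left, hνν]; simp
      have h2 : y - inner ℝ y ν • ν = x - inner ℝ x ν • ν := by rw [h1, hy]; module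
      simp only [Set.mem_ofPred_eq]
      rw [h2, h1]
      linarith
  obtain ⟨z, hz, hzΩ⟩ := mem_closure_iff_nhds.1 (interior_subset ht.1) _ hU
  have := (hgraph z hz.2).1 hzΩ
  exact lt_asymm this hz.1

theorem IsPreconnected.subset_or_subset_compl_closure {X : Type*} [TopologicalSpace X]
    {s Ω : Set X} (hs : IsPreconnected s) (hΩ : IsOpen Ω) (h : Disjoint s (frontier Ω)) :
    s ⊆ Ω ∨ s ⊆ (closure Ω)ᶜ := by
  refine isPreconnected_iff_subset_of_disjoint.1 hs Ω _ hΩ isClosed_closure.isOpen_compl ?_ ?_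
  · intro x hx
    by_contra hx'
    rw [Set.mem_union, not_or, Set.mem_compl_iff, not_not] at hx'
    refine h.le_bot ⟨hx, ?_⟩
    rw [hΩ.frontier_eq]
    exact ⟨hx'.2, hx'.1⟩
  · rw [Set.eq_empty_iff_forall_notMem]
    rintro x ⟨-, h1, h2⟩
    exact h2 (subset_closure h1)

/-- The outward ray from a point of `Ω` beyond the ball would never meet the frontier, hence would
stay in the bounded set `Ω`. -/
theorem IsBoundedLipschitz.subset_closedBall {d : ℕ} {Ω : Set (Pt d)}
    (h : IsBoundedLipschitz Ω) {R : ℝ} (hR : 0 ≤ R) (hfr : frontier Ω ⊆ Metric.closedBall 0 R) :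
    closure Ω ⊆ Metric.closedBall 0 R := by
  refine closure_minimal (fun x hx => ?_) Metric.isClosed_closedBall
  by_contra hxR
  rw [mem_closedBall_zero_iff, not_le] at hxR
  have hs : IsPreconnected ((fun t : ℝ => t • x) '' Set.Ici 1) :=
    isPreconnected_Ici.image _ (by fun_prop)
  have hdisj : Disjoint ((fun t : ℝ => t • x) '' Set.Ici 1) (frontier Ω) := by
    rw [Set.disjoint_left]
    rintro _ ⟨t, ht, rfl⟩ hf
    have h1 := hfr hf
    rw [mem_closedBall_zero_iff, norm_smul, Real.norm_of_nonneg (zero_le_one.trans ht)] at h1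
    have h2 : ‖x‖ ≤ t * ‖x‖ := le_mul_of_one_le_left (norm_nonneg _) ht
    linarith
  rcases IsPreconnected.subset_or_subset_compl_closure hs h.isOpen hdisj with hsub | hsub
  · obtain ⟨B, hB⟩ := h.isBounded.exists_norm_le
    have hx0 : 0 < ‖x‖ := hR.trans_lt hxR
    have h1 := hB _ (hsub ⟨max 1 ((B + 1) / ‖x‖), Set.mem_Ici.2 (le_max_left _ _), rfl⟩)
    rw [norm_smul, Real.norm_of_nonneg (zero_le_one.trans (le_max_left _ _))] at h1
    have h2 : B + 1 ≤ max 1 ((B + 1) / ‖x‖) * ‖x‖ := by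
      rw [← div_le_iff₀ hx0]; exact le_max_right _ _
    linarith
  · exact hsub ⟨1, Set.self_mem_Ici, one_smul _ _⟩ (subset_closure hx)

/-- If the boundary of a regular open set lies near one of its points in a hyperplane, then it fills
the hyperplane near that point. -/
theorem mem_frontier_of_hyperplane {d : ℕ} {Ω : Set (Pt d)} (hΩ : IsOpen Ω)
    (hreg : interior (closure Ω) ⊆ Ω) {φ : Pt d →ᵃ[ℝ] ℝ} {e : Pt d}
    (he : ∀ (y : Pt d) (t : ℝ), φ (y + t • e) = φ y + t) {x : Pt d} (hx : x ∈ frontier Ω) {r : ℝ} (hr : 0 < r)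
    (h : ∀ y ∈ Metric.ball x r, y ∈ frontier Ω → φ y = 0) {y : Pt d} (hy : y ∈ Metric.ball x r)
    (hy0 : φ y = 0) : y ∈ frontier Ω := by
  set P := Metric.ball x r ∩ φ ⁻¹' Set.Ioi 0
  set N := Metric.ball x r ∩ φ ⁻¹' Set.Iio 0
  have hline : ∀ z : Pt d, Tendsto (fun t : ℝ => z + t • e) (𝓝 0) (𝓝 z) := by
    intro z
    have h1 : Continuous (fun t : ℝ => z + t • e) := by fun_prop
    have h2 := h1.tendsto 0
    simpa using h2
  have hP : ∀ z ∈ Metric.ball x r, φ z = 0 → z ∈ closure P := by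
    intro z hz hz0
    refine mem_closure_of_tendsto ((hline z).mono_left (nhdsWithin_le_nhds (s := Set.Ioi 0))) ?_
    filter_upwards [((hline z).mono_left nhdsWithin_le_nhds).eventually
      (Metric.isOpen_ball.mem_nhds hz), self_mem_nhdsWithin] with t ht ht0
    refine ⟨ht, ?_⟩
    rw [Set.mem_preimage, he, hz0, zero_add]
    exact ht0
  have hN : ∀ z ∈ Metric.ball x r, φ z = 0 → z ∈ closure N := by
    intro z hz hz0
    refine mem_closure_of_tendsto ((hline z).mono_left (nhdsWithin_le_nhds (s := Set.Iio 0))) ?_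
    filter_upwards [((hline z).mono_left nhdsWithin_le_nhds).eventually
      (Metric.isOpen_ball.mem_nhds hz), self_mem_nhdsWithin] with t ht ht0
    refine ⟨ht, ?_⟩
    rw [Set.mem_preimage, he, hz0, zero_add]
    exact ht0
  have hPc : IsPreconnected P :=
    ((convex_ball x r).inter ((convex_Ioi 0).affine_preimage φ)).isPreconnected
  have hNc : IsPreconnected N :=
    ((convex_ball x r).inter ((convex_Iio 0).affine_preimage φ)).isPreconnected
  have hPd : Disjoint P (frontier Ω) := by
    rw [Set.disjoint_left]
    exact fun z hz hzf => (ne_of_gt hz.2) (h z hz.1 hzf)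
  have hNd : Disjoint N (frontier Ω) := by
    rw [Set.disjoint_left]
    exact fun z hz hzf => (ne_of_lt hz.2) (h z hz.1 hzf)
  rw [hΩ.frontier_eq] at hx ⊢
  have houter : ∀ {s : Set (Pt d)}, s ⊆ (closure Ω)ᶜ → closure s ⊆ Ωᶜ := fun hs =>
    closure_minimal (hs.trans (Set.compl_subset_compl.2 subset_closure)) hΩ.isClosed_compl
  -- Each half ball is inside or outside. Both inside contradicts regularity at `x`; both outside
  -- contradicts `x ∈ closure Ω`. So `Ω` is on exactly one side, and the whole disc between them is
  -- frontier.
  rcases IsPreconnected.subset_or_subset_compl_closure hPc hΩ hPd with h1 | h1 <;>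
  rcases IsPreconnected.subset_or_subset_compl_closure hNc hΩ hNd with h2 | h2
  · refine absurd (hreg (mem_interior.2 ⟨Metric.ball x r, fun z hz => ?_, Metric.isOpen_ball,
      Metric.mem_ball_self hr⟩)) hx.2
    rcases lt_trichotomy (φ z) 0 with hz0 | hz0 | hz0
    · exact subset_closure (h2 ⟨hz, hz0⟩)
    · exact closure_mono h1 (hP z hz hz0)
    · exact subset_closure (h1 ⟨hz, hz0⟩)
  · exact ⟨closure_mono h1 (hP y hy hy0), houter h2 (hN y hy hy0)⟩
  · exact ⟨closure_mono h2 (hN y hy hy0), houter h1 (hP y hy hy0)⟩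
  · exfalso
    obtain ⟨z, hz, hzΩ⟩ := mem_closure_iff_nhds.1 hx.1 _ (Metric.ball_mem_nhds x hr)
    rcases lt_trichotomy (φ z) 0 with hz0 | hz0 | hz0
    · exact h2 ⟨hz, hz0⟩ (subset_closure hzΩ)
    · exact houter h1 (hP z hz hz0) hzΩ
    · exact h1 ⟨hz, hz0⟩ (subset_closure hzΩ)

/-! ### Facets of a mesh -/

open scoped Classical in
/-- The facets of the elements of a mesh. -/
def Mesh.facets {d : ℕ} (M : Mesh d) : Finset (Finset (Pt d)) :=
  M.elems.biUnion fun T => T.powersetCard d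

theorem Mesh.mem_facets {d : ℕ} {M : Mesh d} {F : Finset (Pt d)} :
    F ∈ M.facets ↔ ∃ T ∈ M.elems, F ∈ T.powersetCard d := by
  simp [Mesh.facets]

theorem Mesh.mem_boundary {d : ℕ} {M : Mesh d} {Γ : Set (Pt d)} {F : Finset (Pt d)} :
    F ∈ M.boundary Γ ↔ F ∈ M.facets ∧ hull F ⊆ Γ := by
  simp [Mesh.boundary, Mesh.facets]

theorem Mesh.card_facet {d : ℕ} {M : Mesh d} {F : Finset (Pt d)} (hF : F ∈ M.facets) :
    F.card = d := by
  obtain ⟨T, -, hT⟩ := Mesh.mem_facets.1 hF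
  exact (Finset.mem_powersetCard.1 hT).2

open scoped Classical in
-- Conformity places a common point in the hull of `T ∩ T'`. Faces of one simplex meet in the hull
-- of their common vertices; this is applied in `T` and then in `T'`.
theorem Mesh.hull_inter_subset {d : ℕ} (M : Mesh d) {T T' F F' : Finset (Pt d)}
    (hT : T ∈ M.elems) (hT' : T' ∈ M.elems) (hF : F ⊆ T) (hF' : F' ⊆ T') :
    hull F ∩ hull F' ⊆ hull (F ∩ F') := by
  rintro x ⟨hx, hx'⟩
  have h1 : x ∈ convexHull ℝ ((T : Set (Pt d)) ∩ (T' : Set (Pt d))) := by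
    rw [← M.conforming T hT T' hT']
    exact ⟨hull_mono hF hx, hull_mono hF' hx'⟩
  rw [← Finset.coe_inter] at h1
  have h2 : x ∈ hull (F ∩ (T ∩ T')) := by
    have := (M.indep T hT).convexHull_inter hF (Finset.inter_subset_left (s₂ := T'))
    rw [hull, Finset.coe_inter, this]
    exact ⟨hx, h1⟩
  have h3 : F ∩ (T ∩ T') ⊆ T' := fun z hz =>
    (Finset.mem_inter.1 (Finset.mem_inter.1 hz).2).2
  have h4 : x ∈ hull (F ∩ (T ∩ T') ∩ F') := by
    have := (M.indep T' hT').convexHull_inter h3 hF'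
    rw [hull, Finset.coe_inter, this]
    exact ⟨h2, hx'⟩
  refine hull_mono (fun z hz => ?_) h4
  simp only [Finset.mem_inter] at hz ⊢
  exact ⟨hz.1.1, hz.2⟩

open scoped Classical in
theorem Mesh.hull_inter_facets_subset {d : ℕ} (M : Mesh d) {F F' : Finset (Pt d)}
    (hF : F ∈ M.facets) (hF' : F' ∈ M.facets) : hull F ∩ hull F' ⊆ hull (F ∩ F') := by
  obtain ⟨T, hT, hFT⟩ := Mesh.mem_facets.1 hF
  obtain ⟨T', hT', hFT'⟩ := Mesh.mem_facets.1 hF'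
  exact M.hull_inter_subset hT hT' (Finset.mem_powersetCard.1 hFT).1
    (Finset.mem_powersetCard.1 hFT').1

/-- The facets meet in the hull of their common vertices. A core point lies on no proper face, so
all vertices of `F` are common, and the cardinalities agree. -/
theorem Mesh.eq_of_mem_core {d : ℕ} (M : Mesh d) {F F' : Finset (Pt d)}
    (hF : F ∈ M.facets) (hF' : F' ∈ M.facets) {x : Pt d} (hx : x ∈ core F) (hx' : x ∈ hull F') :
    F' = F := by
  classical
  refine (Finset.eq_of_subset_of_card_le ?_ ?_).symm
  · intro z hz
    by_contra hz'
    refine hx.2 z hz ?_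
    convert hull_mono ?_ (M.hull_inter_facets_subset hF hF' ⟨hx.1, hx'⟩)
    intro y hy
    obtain ⟨h1, h2⟩ := Finset.mem_inter.1 hy
    exact Finset.mem_erase.2 ⟨fun h => hz' (h ▸ h2), h1⟩
  · rw [M.card_facet hF, M.card_facet hF']

theorem Mesh.surf_inter_eq_zero {d : ℕ} (M : Mesh d) {F F' : Finset (Pt d)}
    (hF : F ∈ M.facets) (hF' : F' ∈ M.facets) (hne : F ≠ F') : surf d (hull F ∩ hull F') = 0 := by
  classical
  refine measure_mono_null (M.hull_inter_facets_subset hF hF') (surf_hull_eq_zero ?_)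
  refine (Finset.card_lt_card (Finset.inter_subset_left.ssubset_of_ne fun h => hne ?_)).trans_eq
    (M.card_facet hF)
  exact Finset.eq_of_subset_of_card_le (Finset.inter_eq_left.1 h)
    (by rw [M.card_facet hF, M.card_facet hF'])

theorem surf_hull_diff_core {d : ℕ} {F : Finset (Pt d)} (hF : F.card = d) :
    surf d (hull F \ core F) = 0 := by
  classical
  have hsub : hull F \ core F ⊆ ⋃ z ∈ F, hull (F.erase z) := by
    rintro x ⟨hx, hx'⟩
    by_contra h
    simp only [Set.mem_iUnion, not_exists] at h
    refine hx' ⟨hx, fun z hz hz' => h z hz ?_⟩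
    convert hz'
  refine measure_mono_null hsub ((measure_biUnion_null_iff F.countable_toSet).2 fun z hz => ?_)
  exact surf_hull_eq_zero ((Finset.card_erase_lt_of_mem hz).trans_eq hF)

/-- The interior of an element lies in the interior of `closure Ω₀`, which is contained in `Ω₀`. A
frontier point is therefore on the boundary of its element. -/
theorem Mesh.exists_facet_of_mem_frontier {d : ℕ} (M : Mesh d) {Ω₀ : Set (Pt d)}
    (hΩ₀ : IsBoundedLipschitz Ω₀) (hcover : cover M.elems = closure Ω₀) {x : Pt d}
    (hx : x ∈ frontier Ω₀) : ∃ F ∈ M.facets, x ∈ hull F := by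
  classical
  rw [hΩ₀.isOpen.frontier_eq, ← hcover] at hx
  obtain ⟨hx1, hx2⟩ := hx
  simp only [cover, Set.mem_iUnion, exists_prop] at hx1
  obtain ⟨T, hT, hxT⟩ := hx1
  obtain ⟨b, hb⟩ := exists_affineBasis (M.card_eq T hT) (M.indep T hT)
  have hint : x ∉ interior (hull T) := by
    intro h
    refine hx2 (hΩ₀.interior_closure_subset (interior_mono ?_ h))
    rw [← hcover]
    exact Set.subset_biUnion_of_mem (u := fun T => hull T) hT
  obtain ⟨a, ha, hxa⟩ := mem_hull_erase_of_notMem_interior b hb hxT hint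
  refine ⟨_, Mesh.mem_facets.2 ⟨T, hT, Finset.mem_powersetCard.2 ⟨Finset.erase_subset _ _, ?_⟩⟩, hxa⟩
  rw [Finset.card_erase_of_mem ha, M.card_eq T hT, Nat.add_sub_cancel]

/-- Near a point in the relative interior of a facet, the boundary lies in that facet. -/
theorem Mesh.eventually_mem_hull {d : ℕ} (M : Mesh d) {Ω₀ : Set (Pt d)}
    (hΩ₀ : IsBoundedLipschitz Ω₀) (hcover : cover M.elems = closure Ω₀) {F : Finset (Pt d)}
    (hF : F ∈ M.facets) {x : Pt d} (hx : x ∈ core F) :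
    ∀ᶠ y in 𝓝 x, y ∈ frontier Ω₀ → y ∈ hull F := by
  classical
  have hclosed : IsClosed (⋃ F' ∈ M.facets.erase F, hull F') :=
    (M.facets.erase F).finite_toSet.isClosed_biUnion fun F' _ => isClosed_hull F'
  have hx' : x ∉ ⋃ F' ∈ M.facets.erase F, hull F' := by
    simp only [Set.mem_iUnion, exists_prop, not_exists, not_and]
    intro F' hF' hxF'
    obtain ⟨h1, h2⟩ := Finset.mem_erase.1 hF'
    exact h1 (M.eq_of_mem_core hF h2 hx hxF')
  filter_upwards [hclosed.isOpen_compl.mem_nhds hx'] with y hy hyf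
  obtain ⟨F', hF', hyF'⟩ := M.exists_facet_of_mem_frontier hΩ₀ hcover hyf
  rcases eq_or_ne F' F with rfl | hne
  · exact hyF'
  · exact absurd (Set.mem_biUnion (Finset.mem_erase.2 ⟨hne, hF'⟩) hyF') hy

/-- A facet whose relative interior meets the boundary is contained in the boundary. -/
theorem Mesh.hull_subset_of_mem_core {d : ℕ} (M : Mesh d) {Ω Ω₀ : Set (Pt d)}
    (hΩ : IsBoundedLipschitz Ω) (hΩ₀ : IsBoundedLipschitz Ω₀) (hcover : cover M.elems = closure Ω₀)
    (hfr : frontier Ω ⊆ frontier Ω₀) {F : Finset (Pt d)} (hF : F ∈ M.facets) (hd : 1 ≤ d) {x : Pt d}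
    (hx : x ∈ core F) (hxΩ : x ∈ frontier Ω) : hull F ⊆ frontier Ω := by
  classical
  obtain ⟨T, hT, hFT⟩ := Mesh.mem_facets.1 hF
  obtain ⟨b, hb⟩ := exists_affineBasis (M.card_eq T hT) (M.indep T hT)
  obtain ⟨a, ha, hFa⟩ := exists_erase_eq (M.card_eq T hT) hFT
  have hcore : ∀ y, y ∈ core F ↔ b.coord ⟨a, ha⟩ y = 0 ∧ ∀ i, i ≠ ⟨a, ha⟩ → 0 < b.coord i y := by
    intro y
    rw [hFa]
    convert mem_core_erase_iff b hb ⟨a, ha⟩ y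
  set φ := b.coord ⟨a, ha⟩
  obtain ⟨c, hc, hca⟩ := Finset.exists_mem_ne (by rw [M.card_eq T hT]; omega : 1 < T.card) a
  have he : ∀ (y : Pt d) (t : ℝ), φ (y + t • (a - c)) = φ y + t := by
    intro y t
    have h1 : φ a = 1 := by
      have := b.coord_apply_eq ⟨a, ha⟩
      rwa [hb] at this
    have h2 : φ c = 0 := by
      have := b.coord_apply_ne (i := ⟨a, ha⟩) (j := ⟨c, hc⟩) fun h => hca (congrArg Subtype.val h).symm
      rwa [hb] at this
    have h3 : φ.linear (a - c) = 1 := by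
      have := φ.linearMap_vsub a c
      rw [h1, h2] at this
      simpa using this
    have h4 := φ.map_vadd y (t • (a - c))
    rw [map_smul, h3] at h4
    simp only [vadd_eq_add, smul_eq_mul, mul_one] at h4
    rw [add_comm y, h4, add_comm]
  -- Near `y` the set `∂Ω ⊆ ∂Ω₀` lies in `F`, hence in the hyperplane `φ = 0`, and must then fill
  -- it.
  have hopen : ∀ y ∈ core F, y ∈ frontier Ω → ∀ᶠ z in 𝓝 y, φ z = 0 → z ∈ frontier Ω := by
    intro y hy hyΩ
    obtain ⟨r, hr, hball⟩ := Metric.eventually_nhds_iff_ball.1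
      (M.eventually_mem_hull hΩ₀ hcover hF hy)
    filter_upwards [Metric.ball_mem_nhds y hr] with z hz hz0
    refine mem_frontier_of_hyperplane hΩ.isOpen hΩ.interior_closure_subset he hyΩ hr
      (fun z' hz' hzf => ?_) hz hz0
    have h1 := hball z' hz' (hfr hzf)
    rw [hFa, mem_hull_iff_coord b hb (Finset.erase_subset _ _)] at h1
    exact (h1 ⟨a, ha⟩).2 (by simp)
  have hconv : Convex ℝ (core F) := by
    have h1 : core F = φ ⁻¹' {0} ∩ ⋂ i : {i // i ≠ (⟨a, ha⟩ : T)}, b.coord i ⁻¹' Set.Ioi 0 := by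
      ext y
      rw [hcore]
      simp
    rw [h1]
    exact ((convex_singleton 0).affine_preimage φ).inter
      (convex_iInter fun i => (convex_Ioi 0).affine_preimage _)
  have hsub : core F ⊆ frontier Ω := by
    -- The points of the core in `∂Ω` form a relatively open and closed subset, and the core is
    -- connected.
    have h1 := isPreconnected_iff_subset_of_disjoint.1 hconv.isPreconnected
      {y | ∀ᶠ z in 𝓝 y, φ z = 0 → z ∈ frontier Ω} (frontier Ω)ᶜ isOpen_setOfPred_eventually_nhds
      isClosed_frontier.isOpen_compl (fun y hy => ?_) ?_
    · rcases h1 with h1 | h1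
      · exact fun y hy => (h1 hy).self_of_nhds ((hcore y).1 hy).1
      · exact absurd hxΩ (h1 hx)
    · by_cases hyf : y ∈ frontier Ω
      · exact .inl (hopen y hy hyf)
      · exact .inr hyf
    · rw [Set.eq_empty_iff_forall_notMem]
      rintro y ⟨hy, h2, h3⟩
      exact h3 (h2.self_of_nhds ((hcore y).1 hy).1)
  intro y hy
  have hline : Tendsto (fun t : ℝ => (lineMap y x t : Pt d)) (𝓝[>] 0) (𝓝 y) := by
    have h2 := (AffineMap.lineMap_continuous (p := y) (q := x) (R := ℝ)).tendsto 0
    rw [AffineMap.lineMap_apply_zero] at h2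
    exact h2.mono_left nhdsWithin_le_nhds
  refine isClosed_frontier.mem_of_tendsto hline ?_
  have hIoo : Set.Ioo (0 : ℝ) 1 ∈ 𝓝[>] (0 : ℝ) := Ioo_mem_nhdsGT zero_lt_one
  filter_upwards [hIoo] with t ht
  refine hsub ((hcore _).2 ?_)
  rw [hFa, mem_hull_iff_coord b hb (Finset.erase_subset _ _)] at hy
  have hx' := (hcore x).1 hx
  refine ⟨?_, fun i hi => ?_⟩
  · rw [coord_lineMap, (hy ⟨a, ha⟩).2 (by simp), hx'.1]
    simp
  · rw [coord_lineMap]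
    have h1 := mul_nonneg (sub_nonneg.2 ht.2.le) (hy i).1
    have h2 := mul_pos ht.1 (hx'.2 i hi)
    linarith

/-- Tangent vectors are limits of multiples of differences `y - x` with `y` in the facet.
Conversely, the segments from `x` to the vertices lie in `Γ`, and their directions span. -/
theorem span_tangentConeAt_eq {d : ℕ} {Γ : Set (Pt d)} {F : Finset (Pt d)} {x : Pt d}
    (hx : x ∈ hull F) (hnear : ∀ᶠ y in 𝓝 x, y ∈ Γ → y ∈ hull F) (hF : hull F ⊆ Γ) :
    Submodule.span ℝ (tangentConeAt ℝ Γ x) = vectorSpan ℝ (F : Set (Pt d)) := by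
  have hmem : ∀ y ∈ hull F, y - x ∈ vectorSpan ℝ (F : Set (Pt d)) := by
    intro y hy
    have h := AffineSubspace.vsub_mem_direction (convexHull_subset_affineSpan (𝕜 := ℝ) _ hy)
      (convexHull_subset_affineSpan _ hx)
    rwa [direction_affineSpan] at h
  refine le_antisymm (Submodule.span_le.2 fun y hy => ?_) ?_
  · obtain ⟨c, e, he0, heΓ, hce⟩ := mem_tangentConeAt_iff_exists_seq.1 hy
    refine (Submodule.closed_of_finiteDimensional _).mem_of_tendsto hce ?_
    have h1 : Tendsto (fun n => x + e n) atTop (𝓝 x) := by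
      simpa using he0.const_add x
    filter_upwards [heΓ, h1.eventually hnear] with n h2 h3
    refine Submodule.smul_mem _ _ ?_
    have := hmem _ (h3 h2)
    rwa [add_sub_cancel_left] at this
  · rw [vectorSpan_def, Submodule.span_le]
    rintro _ ⟨y, hy, z, hz, rfl⟩
    have h1 : ∀ y ∈ F, y - x ∈ Submodule.span ℝ (tangentConeAt ℝ Γ x) := fun y hy =>
      Submodule.subset_span (mem_tangentConeAt_of_segment_subset
        (((convex_hull F).segment_subset hx (subset_hull hy)).trans hF))
    have h2 := Submodule.sub_mem _ (h1 y hy) (h1 z hz)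
    rw [sub_sub_sub_cancel_right] at h2
    exact h2

/-! ### Discrete functions on the elements -/

theorem contDiff_evalAt {d : ℕ} (P : MvPolynomial (Fin d) ℝ) : ContDiff ℝ 1 (evalAt P) := by
  induction P using MvPolynomial.induction_on with
  | C a =>
    have : evalAt (d := d) (MvPolynomial.C a) = fun _ => a := by funext x; simp [evalAt]
    rw [this]
    exact contDiff_const
  | add p q hp hq =>
    have : evalAt (p + q) = fun x => evalAt p x + evalAt q x := by funext x; simp [evalAt]
    rw [this]
    exact hp.add hq
  | mul_X p i hp =>
    have : evalAt (p * MvPolynomial.X i) = fun x => evalAt p x * x i := by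
      funext x; simp [evalAt]
    rw [this]
    exact hp.mul (by fun_prop)

/-- The gradients are known to agree only in the interior of the element, but the frontier of a
convex set is a null set. -/
theorem eta_eq_of_eqOn {d : ℕ} {T : Finset (Pt d)} {w : Pt d → ℝ} {P : MvPolynomial (Fin d) ℝ}
    (h : ∀ x ∈ hull T, w x = evalAt P x) :
    eta w T = eLpNorm (gradient (evalAt P)) 2 (volume.restrict (hull T)) := by
  refine eLpNorm_congr_ae ?_
  have h0 : volume (frontier (hull T)) = 0 := (convex_hull T).addHaar_frontier volume
  have h1 : ∀ᵐ x ∂(volume.restrict (hull T)), x ∉ frontier (hull T) :=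
    ae_restrict_of_ae (measure_eq_zero_iff_ae_notMem.1 h0)
  filter_upwards [h1, ae_restrict_mem (measurableSet_hull T)] with x hx hxT
  have hxi : x ∈ interior (hull T) := by
    by_contra hn
    exact hx ⟨subset_closure hxT, hn⟩
  have h2 : w =ᶠ[𝓝 x] evalAt P := by
    filter_upwards [isOpen_interior.mem_nhds hxi] with y hy using h y (interior_subset hy)
  rw [gradient, gradient, h2.fderiv_eq]

theorem Mesh.interior_hull_nonempty {d : ℕ} (M : Mesh d) {T : Finset (Pt d)} (hT : T ∈ M.elems) :
    (interior (hull T)).Nonempty := by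
  obtain ⟨b, hb⟩ := exists_affineBasis (M.card_eq T hT) (M.indep T hT)
  have h := b.tot
  have h2 : Set.range b = (T : Set (Pt d)) := by ext x; simp [hb]
  rw [h2] at h
  exact interior_convexHull_nonempty_iff_affineSpan_eq_top.2 h

/-- Ensures that `w` is a polynomial on the element behind every boundary facet. -/
theorem Mesh.mem_kPatch {d : ℕ} (M : Mesh d) {Γ : Set (Pt d)} {T : Finset (Pt d)}
    (hT : T ∈ M.elems) (hTΓ : (hull T ∩ Γ).Nonempty) {k : ℕ} (hk : 1 ≤ k) : T ∈ M.kPatch Γ k := by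
  classical
  induction k, hk using Nat.le_induction with
  | base =>
    rw [Mesh.kPatch, Mesh.patch]
    exact Finset.mem_filter.2 ⟨hT, hTΓ.mono (Set.inter_subset_inter_right _ subset_closure)⟩
  | succ k hk ih =>
    obtain ⟨j, rfl⟩ := Nat.exists_eq_add_of_le' hk
    rw [Mesh.kPatch, Mesh.patch]
    refine Finset.mem_filter.2 ⟨hT, ?_⟩
    obtain ⟨x, hx⟩ := M.interior_hull_nonempty hT
    refine ⟨x, interior_subset hx, subset_closure (interior_mono ?_ hx)⟩
    exact Set.subset_biUnion_of_mem (u := fun T => hull T) ih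

/-! ### Mesh size, diameter and height under shape regularity -/

theorem Mesh.size_pos {d : ℕ} (M : Mesh d) {T : Finset (Pt d)} (hT : T ∈ M.elems) :
    0 < size T := by
  refine Real.rpow_pos_of_pos ?_ _
  refine ENNReal.toReal_pos ?_ (isCompact_hull T).measure_lt_top.ne
  exact (Measure.measure_pos_of_nonempty_interior _ (M.interior_hull_nonempty hT)).ne'

theorem Mesh.size_le_h {d : ℕ} (M : Mesh d) {T : Finset (Pt d)} (hT : T ∈ M.elems) {x : Pt d}
    (hx : x ∈ hull T) : size T ≤ M.h x := by
  refine le_csSup ?_ ⟨T, hT, hx, rfl⟩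
  refine ((M.elems.finite_toSet.image size).subset ?_).bddAbove
  rintro _ ⟨S, hS, -, rfl⟩
  exact ⟨S, hS, rfl⟩

theorem size_pow {d : ℕ} (hd : d ≠ 0) (T : Finset (Pt d)) :
    size T ^ d = volume.real (hull T) := by
  rw [size, one_div, Real.rpow_inv_natCast_pow measureReal_nonneg hd]

theorem size_le_of_subset_closedBall {d : ℕ} {T : Finset (Pt d)} {R : ℝ}
    (h : hull T ⊆ Metric.closedBall 0 R) :
    size T ≤ (volume.real (Metric.closedBall (0 : Pt d) R)) ^ (1 / (d : ℝ)) :=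
  Real.rpow_le_rpow measureReal_nonneg
    (measureReal_mono h measure_closedBall_lt_top.ne) (by positivity)

theorem Mesh.norm_sub_le {d : ℕ} {M : Mesh d} {κ : ℝ} (hκ : M.ShapeRegular κ)
    {T : Finset (Pt d)} (hT : T ∈ M.elems) {x y : Pt d} (hx : x ∈ hull T) (hy : y ∈ hull T) :
    ‖x - y‖ ≤ κ * size T := by
  rw [← dist_eq_norm]
  exact (Metric.dist_le_diam_of_mem (isCompact_hull T).isBounded hx hy).trans (hκ T hT)

/-- The volume of the unit ball of `ℝ^n`. -/
def unitBallVolume (n : ℕ) : ℝ :=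
  volume.real (Metric.closedBall (0 : EuclideanSpace ℝ (Fin n)) 1)

theorem surf_hull_ne_top {d : ℕ} {F : Finset (Pt d)} (hd : 1 ≤ d) {a v : Pt d} (hv : v ≠ 0)
    (hFv : ∀ x ∈ hull F, inner ℝ v (x - a) = ‖v‖ ^ 2) : surf d (hull F) ≠ ⊤ := by
  have hn : Module.finrank ℝ (Pt d) = (d - 1) + 1 := by
    rw [finrank_euclideanSpace_fin]; omega
  obtain ⟨D, hD⟩ := Metric.isBounded_iff.1 (isCompact_hull F).isBounded
  refine ((measure_le_of_subset_hyperplane hn hv (D := max D 0) (fun x hx y hy => ?_)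
    (le_max_right _ _) fun x hx y hy => ?_).trans_lt ?_).ne
  · have h1 := hFv x hx
    have h2 := hFv y hy
    rw [inner_sub_right] at h1 h2 ⊢
    linarith
  · rw [← dist_eq_norm]
    exact (hD hx hy).trans (le_max_left _ _)
  · exact ENNReal.mul_lt_top (by finiteness) measure_closedBall_lt_top

open scoped Classical in
/-- In a shape regular mesh the heights of a simplex are comparable to its size. -/
theorem Mesh.exists_height_ge {d : ℕ} (hd : 1 ≤ d) {M : Mesh d} {κ : ℝ} (hκ : M.ShapeRegular κ)
    {T : Finset (Pt d)} (hT : T ∈ M.elems) {a : Pt d} (ha : a ∈ T) :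
    ∃ v : Pt d, v ≠ 0 ∧ (∀ x ∈ hull (T.erase a), inner ℝ v (x - a) = ‖v‖ ^ 2) ∧
      size T ≤ unitBallVolume (d - 1) * κ ^ (d - 1) * ‖v‖ := by
  have hn : Module.finrank ℝ (Pt d) = (d - 1) + 1 := by
    rw [finrank_euclideanSpace_fin]; omega
  obtain ⟨b, hb⟩ := exists_affineBasis (M.card_eq T hT) (M.indep T hT)
  obtain ⟨v, hv, hvx⟩ := exists_height b hb (by rw [M.card_eq T hT]; omega) ⟨a, ha⟩
  refine ⟨v, hv, fun x hx => ?_, ?_⟩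
  · rw [mem_hull_iff_coord b hb (Finset.erase_subset _ _)] at hx
    rw [hvx, (hx ⟨a, ha⟩).2 (by simp)]
    ring
  have hs := M.size_pos hT
  have hD0 : 0 ≤ κ * size T :=
    (norm_nonneg _).trans (M.norm_sub_le hκ hT (subset_hull ha) (subset_hull ha))
  have hv2 : 0 ≤ ‖v‖ ^ 2 := by positivity
  have hvol := volume_le_of_subset_slab hn a hv (measurableSet_hull T) (fun x hx => ?_) hD0
    fun x hx y hy => M.norm_sub_le hκ hT hx hy
  · have hreal := ENNReal.toReal_mono (by
      exact ENNReal.mul_ne_top (by simp) (ENNReal.mul_ne_top (by finiteness)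
        measure_closedBall_lt_top.ne)) hvol
    rw [ENNReal.toReal_mul, ENNReal.toReal_mul, ENNReal.toReal_pow, ENNReal.toReal_ofReal hD0,
      toReal_enorm] at hreal
    change volume.real (hull T) ≤ ‖v‖ * ((κ * size T) ^ (d - 1) * unitBallVolume (d - 1)) at hreal
    rw [← size_pow (by omega) T] at hreal
    obtain ⟨n, rfl⟩ : ∃ n, d = n + 1 := ⟨d - 1, by omega⟩
    simp only [Nat.add_sub_cancel] at hreal ⊢
    -- The slab bound reads `h^d ≤ ‖v‖ (κ h)^{d-1}` times the unit ball volume; cancel `h^{d-1}`.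
    have h1 : size T ^ n * size T ≤ size T ^ n * (unitBallVolume n * κ ^ n * ‖v‖) := by
      rw [← pow_succ]
      refine hreal.trans_eq ?_
      ring
    exact le_of_mul_le_mul_left h1 (by positivity)
  · rw [mem_hull_iff_coord b hb subset_rfl] at hx
    have h0 := (hx ⟨a, ha⟩).1
    have h1 : b.coord ⟨a, ha⟩ x ≤ 1 := by
      rw [← b.sum_coord_apply_eq_one x]
      exact Finset.single_le_sum (f := fun i => b.coord i x) (fun i _ => (hx i).1)
        (Finset.mem_univ _)
    rw [hvx]
    constructor
    · exact mul_nonneg (by linarith) hv2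
    · nlinarith

/-! ### Decomposition of surface measure and tangential gradient into facets -/

/-- Up to a null set, `Γ` is the union of the facets of the boundary mesh. -/
theorem Mesh.sigma_eq_restrict_iUnion {d : ℕ} (hd : 1 ≤ d) (M : Mesh d) {Γ Ω Ω₀ : Set (Pt d)}
    (hΩ : IsBoundedLipschitz Ω) (hΩ₀ : IsBoundedLipschitz Ω₀) (hcover : cover M.elems = closure Ω₀)
    (hΓ : frontier Ω = Γ) (hfr : Γ ⊆ frontier Ω₀) :
    sigma Γ = (surf d).restrict (⋃ F ∈ M.boundary Γ, hull F) := by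
  have hsub : (⋃ F ∈ M.boundary Γ, hull F) ⊆ Γ :=
    Set.iUnion₂_subset fun F hF => (Mesh.mem_boundary.1 hF).2
  -- If a point of `Γ` is in the core of a facet, that facet lies in `Γ`. What remains is on
  -- lower-dimensional faces.
  have hdiff : Γ \ (⋃ F ∈ M.boundary Γ, hull F) ⊆ ⋃ F ∈ M.facets, hull F \ core F := by
    rintro x ⟨hxΓ, hx⟩
    obtain ⟨F, hF, hxF⟩ := M.exists_facet_of_mem_frontier hΩ₀ hcover (hfr hxΓ)
    refine Set.mem_biUnion hF ⟨hxF, fun hc => hx ?_⟩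
    subst hΓ
    exact Set.mem_biUnion (Mesh.mem_boundary.2
      ⟨hF, M.hull_subset_of_mem_core hΩ hΩ₀ hcover hfr hF hd hc hxΓ⟩) hxF
  have hnull : surf d (Γ \ ⋃ F ∈ M.boundary Γ, hull F) = 0 :=
    measure_mono_null hdiff ((measure_biUnion_null_iff M.facets.countable_toSet).2
      fun F hF => surf_hull_diff_core (M.card_facet hF))
  refine Measure.restrict_congr_set ?_
  refine (ae_le_set.2 hnull).antisymm (ae_le_set.2 ?_)
  rw [Set.sdiff_eq_empty.2 hsub, measure_empty]

theorem Mesh.lintegral_sigma {d : ℕ} (hd : 1 ≤ d) (M : Mesh d) {Γ Ω Ω₀ : Set (Pt d)}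
    (hΩ : IsBoundedLipschitz Ω) (hΩ₀ : IsBoundedLipschitz Ω₀) (hcover : cover M.elems = closure Ω₀)
    (hΓ : frontier Ω = Γ) (hfr : Γ ⊆ frontier Ω₀) (f : Pt d → ℝ≥0∞) :
    ∫⁻ x, f x ∂(sigma Γ) = ∑ F ∈ M.boundary Γ, ∫⁻ x in hull F, f x ∂(surf d) := by
  rw [M.sigma_eq_restrict_iUnion hd hΩ hΩ₀ hcover hΓ hfr]
  refine lintegral_biUnion_finset₀ (fun F hF F' hF' hne => ?_)
    (fun F _ => (measurableSet_hull F).nullMeasurableSet) f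
  exact M.surf_inter_eq_zero (Mesh.mem_boundary.1 hF).1 (Mesh.mem_boundary.1 hF').1 hne

theorem sigma_restrict_hull {d : ℕ} {Γ : Set (Pt d)} {F : Finset (Pt d)} (hF : hull F ⊆ Γ) :
    (sigma Γ).restrict (hull F) = (surf d).restrict (hull F) := by
  rw [sigma, Measure.restrict_restrict (measurableSet_hull F), Set.inter_eq_left.2 hF]

theorem restrict_hull_le_sigma {d : ℕ} {Γ : Set (Pt d)} {F : Finset (Pt d)} (hF : hull F ⊆ Γ) :
    (surf d).restrict (hull F) ≤ sigma Γ :=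
  Measure.restrict_mono hF le_rfl

/-- On a facet of the boundary mesh the tangential gradient is the projection to the facet. -/
theorem Mesh.tangGrad_ae_eq {d : ℕ} (M : Mesh d) {Γ Ω₀ : Set (Pt d)}
    (hΩ₀ : IsBoundedLipschitz Ω₀) (hcover : cover M.elems = closure Ω₀)
    (hfr : Γ ⊆ frontier Ω₀) {F : Finset (Pt d)} (hF : F ∈ M.boundary Γ) (f : Pt d → ℝ) :
    tangGrad Γ f =ᵐ[(surf d).restrict (hull F)]
      fun x => (vectorSpan ℝ (F : Set (Pt d))).starProjection (gradient f x) := by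
  obtain ⟨hFf, hFΓ⟩ := Mesh.mem_boundary.1 hF
  have h1 : ∀ᵐ x ∂((surf d).restrict (hull F)), x ∈ core F := by
    rw [ae_restrict_iff' (measurableSet_hull F), ae_iff]
    refine measure_mono_null (fun x hx => ?_) (surf_hull_diff_core (M.card_facet hFf))
    simp only [Set.mem_ofPred_eq, Classical.not_imp] at hx
    exact hx
  filter_upwards [h1] with x hx
  have h2 := span_tangentConeAt_eq hx.1
    ((M.eventually_mem_hull hΩ₀ hcover hFf hx).mono fun y hy hyΓ => hy (hfr hyΓ)) hFΓ
  simp only [tangGrad, h2]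

/-! ### The residual on a single facet -/

/-- The estimate of a function with integral mean zero on a facet. -/
theorem Mesh.eLpNorm_facet_le {d : ℕ} (hd : 1 ≤ d) {M : Mesh d} {κ H : ℝ} (hκ : M.ShapeRegular κ)
    {T F : Finset (Pt d)} (hT : T ∈ M.elems) (hFT : F ∈ T.powersetCard d) (hH : size T ≤ H)
    {Γ Ω₀ : Set (Pt d)} (hΩ₀ : IsBoundedLipschitz Ω₀) (hcover : cover M.elems = closure Ω₀)
    (hfr : Γ ⊆ frontier Ω₀) (hFΓ : hull F ⊆ Γ) {v r u : Pt d → ℝ} {p : Pt d → Pt d}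
    (hrp : HasSurfaceGradient Γ r p) (hv : MemLp v 2 (sigma Γ)) (hvr : v = r + u)
    (hv0 : ∫ x in hull F, v x ∂(surf d) = 0) {P : MvPolynomial (Fin d) ℝ}
    (hu : ∀ x ∈ hull F, u x = evalAt P x) :
    eLpNorm v 2 ((surf d).restrict (hull F)) ≤
      ENNReal.ofReal (2 ^ (d - 1) * (κ * √H)) *
        eLpNorm (fun x => (M.h x) ^ (1 / 2 : ℝ) • p x) 2 ((surf d).restrict (hull F))
      + ENNReal.ofReal (12 * 2 ^ (d - 1) * 2 ^ (d - 1) *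
          (κ * √(unitBallVolume (d - 1) * κ ^ (d - 1)) * √H)) *
        eLpNorm (gradient (evalAt P)) 2 (volume.restrict (hull T)) := by
  classical
  have hn : Module.finrank ℝ (Pt d) = (d - 1) + 1 := by
    rw [finrank_euclideanSpace_fin]; omega
  have hFb : F ∈ M.boundary Γ :=
    Mesh.mem_boundary.2 ⟨Mesh.mem_facets.2 ⟨T, hT, hFT⟩, hFΓ⟩
  have hFsub : hull F ⊆ hull T := hull_mono (Finset.mem_powersetCard.1 hFT).1
  obtain ⟨a, ha, hFa⟩ := exists_erase_eq (M.card_eq T hT) hFT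
  obtain ⟨ν, hν, hνF, hsize⟩ := M.exists_height_ge hd hκ hT ha
  have hνF' : ∀ x ∈ hull F, inner ℝ ν (x - a) = ‖ν‖ ^ 2 := fun x hx => hνF x (by
    convert (hFa ▸ hx : x ∈ hull (T.erase a)))
  have hs := M.size_pos hT
  have hD0 : 0 ≤ κ * size T :=
    (norm_nonneg _).trans (M.norm_sub_le hκ hT (subset_hull ha) (subset_hull ha))
  have hκ0 : 0 ≤ κ := nonneg_of_mul_nonneg_left hD0 hs
  have hfin := surf_hull_ne_top hd hν hνF'
  have : IsFiniteMeasure ((surf d).restrict (hull F)) := ⟨by simpa using hfin.lt_top⟩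
  have hle := restrict_hull_le_sigma hFΓ
  have hpc := contDiff_evalAt P
  obtain ⟨hr, hp, f, hf, hfr', hfp⟩ := hrp
  have hzero : ∀ {φ : ℕ → ℝ≥0∞} {ψ : ℕ → ℝ≥0∞}, (∀ k, φ k ≤ ψ k) → Tendsto ψ atTop (𝓝 0) →
      Tendsto φ atTop (𝓝 0) := fun h hψ =>
    tendsto_of_tendsto_of_tendsto_of_le_of_le tendsto_const_nhds hψ (fun _ => zero_le) h
  have hum : u =ᵐ[(surf d).restrict (hull F)] evalAt P :=
    (ae_restrict_iff' (measurableSet_hull F)).2 (.of_forall hu)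
  have hcone := exists_const_eLpNorm_sub_le_cone hn hν (measurableSet_hull F) (convex_hull F) hfin
    hνF' (measurableSet_hull T)
    (fun x hx s hs => (convex_hull T).lineMap_mem (subset_hull ha) (hFsub hx)
      ⟨by linarith [hs.1], hs.2⟩)
    (fun x hx => M.norm_sub_le hκ hT (hFsub hx) (subset_hull ha))
    (fun x hx y hy => M.norm_sub_le hκ hT (hFsub hy) (hFsub hx)) hpc
  have hcone' : ∃ c, eLpNorm (fun x => u x - c) 2 ((surf d).restrict (hull F)) ≤
      12 * 2 ^ (d - 1) * 2 ^ (d - 1) * ENNReal.ofReal (κ * size T) * ENNReal.ofReal (√‖ν‖)⁻¹ *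
        eLpNorm (gradient (evalAt P)) 2 (volume.restrict (hull T)) := by
    obtain ⟨c, hc⟩ := hcone
    refine ⟨c, (le_of_eq (eLpNorm_congr_ae ?_)).trans hc⟩
    filter_upwards [hum] with x hx
    rw [hx]
  have hmain := eLpNorm_le_of_tendsto (d - 1) (measurableSet_hull F) (convex_hull F) hfin
    (V := vectorSpan ℝ (F : Set (Pt d))) (fun x hx y hy => by
      have h := AffineSubspace.vsub_mem_direction (convexHull_subset_affineSpan (𝕜 := ℝ) _ hy)
        (convexHull_subset_affineSpan _ hx)
      rwa [direction_affineSpan] at h)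
    (fun x hx y hy => M.norm_sub_le hκ hT (hFsub hy) (hFsub hx))
    (fun k => (hf k).of_le (by simp)) (hr.1.mono_measure hle)
    (hpc.continuous.aestronglyMeasurable.congr hum.symm) (hp.1.mono_measure hle)
    (hzero (fun k => eLpNorm_mono_measure _ hle) hfr')
    (hzero (fun k => (le_of_eq (eLpNorm_congr_ae (by
      filter_upwards [M.tangGrad_ae_eq hΩ₀ hcover hfr hFb (f k)] with x hx
      rw [Pi.sub_apply, hx]))).trans (eLpNorm_mono_measure (tangGrad Γ (f k) - p) hle)) hfp)
    (fun c => eLpNorm_le_eLpNorm_sub_const (hv.mono_measure hle) hv0 c)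
    (Filter.EventuallyEq.of_eq hvr) hcone'
  have h2 : (2 : ℝ≥0∞) ^ (d - 1) = ENNReal.ofReal (2 ^ (d - 1)) := by
    rw [ENNReal.ofReal_pow (by norm_num), ENNReal.ofReal_ofNat]
  refine hmain.trans (add_le_add ?_ ?_)
  · have hpx : ∀ᵐ x ∂((surf d).restrict (hull F)),
        ‖p x‖ ≤ (√(size T))⁻¹ * ‖(M.h x) ^ (1 / 2 : ℝ) • p x‖ := by
      filter_upwards [ae_restrict_mem (measurableSet_hull F)] with x hx
      rw [← Real.sqrt_eq_rpow, norm_smul, Real.norm_of_nonneg (Real.sqrt_nonneg _), ← mul_assoc]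
      refine le_mul_of_one_le_left (norm_nonneg _) ?_
      rw [← div_eq_inv_mul, one_le_div (Real.sqrt_pos.2 hs)]
      exact Real.sqrt_le_sqrt (M.size_le_h hT (hFsub hx))
    have h1 := eLpNorm_le_mul_eLpNorm_of_ae_le_mul hpx 2
    calc 2 ^ (d - 1) * ENNReal.ofReal (κ * size T) * eLpNorm p 2 ((surf d).restrict (hull F))
        ≤ 2 ^ (d - 1) * ENNReal.ofReal (κ * size T) * (ENNReal.ofReal (√(size T))⁻¹ *
          eLpNorm (fun x => (M.h x) ^ (1 / 2 : ℝ) • p x) 2 ((surf d).restrict (hull F))) := by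
          gcongr
      _ = ENNReal.ofReal (2 ^ (d - 1) * (κ * √(size T))) *
          eLpNorm (fun x => (M.h x) ^ (1 / 2 : ℝ) • p x) 2 ((surf d).restrict (hull F)) := by
          rw [← mul_assoc, mul_assoc (2 ^ (d - 1)), ← ENNReal.ofReal_mul hD0, h2,
            ← ENNReal.ofReal_mul (by positivity), ← div_eq_mul_inv, mul_div_assoc, Real.div_sqrt]
      _ ≤ _ := by gcongr
  · refine mul_le_mul' ?_ le_rfl
    have hν0 : 0 < √‖ν‖ := Real.sqrt_pos.2 (norm_pos_iff.2 hν)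
    -- The height is at least a multiple of `h_T`, so diameter over root of height is of order
    -- `h_T^{1/2}`.
    have h1 : κ * size T * (√‖ν‖)⁻¹ ≤ κ * √(unitBallVolume (d - 1) * κ ^ (d - 1)) * √H := by
      have h3 : √(size T) ≤ √(unitBallVolume (d - 1) * κ ^ (d - 1)) * √‖ν‖ := by
        rw [← Real.sqrt_mul' _ (norm_nonneg _)]
        exact Real.sqrt_le_sqrt hsize
      rw [← div_eq_mul_inv, div_le_iff₀ hν0]
      calc κ * size T = κ * (√(size T) * √(size T)) := by rw [Real.mul_self_sqrt hs.le]
        _ ≤ κ * ((√(unitBallVolume (d - 1) * κ ^ (d - 1)) * √‖ν‖) * √H) := by gcongr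
        _ = _ := by ring
    calc _ = ENNReal.ofReal (12 * 2 ^ (d - 1) * 2 ^ (d - 1) * (κ * size T * (√‖ν‖)⁻¹)) := by
          rw [mul_assoc _ (ENNReal.ofReal _) (ENNReal.ofReal _), ← ENNReal.ofReal_mul hD0, h2,
            ← ENNReal.ofReal_ofNat 12, ← ENNReal.ofReal_mul (by positivity),
            ← ENNReal.ofReal_mul (by positivity), ← ENNReal.ofReal_mul (by positivity)]
      _ ≤ _ := by gcongr

/-! ### Galerkin orthogonality and summation over the facets -/

theorem lintegral_enorm_mul_le {α : Type*} [MeasurableSpace α] {μ : Measure α} {f g : α → ℝ}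
    (hf : AEStronglyMeasurable f μ) (hg : AEStronglyMeasurable g μ) :
    ∫⁻ x, ‖f x * g x‖ₑ ∂μ ≤ eLpNorm f 2 μ * eLpNorm g 2 μ := by
  have h := ENNReal.lintegral_mul_le_Lp_mul_Lq μ Real.HolderConjugate.two_two hf.enorm hg.enorm
  rw [eLpNorm_eq_lintegral_rpow_enorm_toReal two_ne_zero ENNReal.ofNat_ne_top,
    eLpNorm_eq_lintegral_rpow_enorm_toReal two_ne_zero ENNReal.ofNat_ne_top]
  simpa [enorm_mul] using h

theorem sum_mul_le_of_sum_sq_le {ι : Type*} (s : Finset ι) (f g : ι → ℝ≥0∞) {A B : ℝ≥0∞}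
    (hf : ∑ i ∈ s, f i ^ 2 ≤ A ^ 2) (hg : ∑ i ∈ s, g i ^ 2 ≤ B ^ 2) :
    ∑ i ∈ s, f i * g i ≤ A * B := by
  have h := ENNReal.inner_le_Lp_mul_Lq s f g Real.HolderConjugate.two_two
  simp only [ENNReal.rpow_ofNat] at h
  have hsqrt : ∀ x : ℝ≥0∞, (x ^ 2) ^ (1 / 2 : ℝ) = x := fun x => by
    rw [← ENNReal.rpow_natCast, ← ENNReal.rpow_mul]; norm_num
  calc ∑ i ∈ s, f i * g i ≤ (∑ i ∈ s, f i ^ 2) ^ (1 / 2 : ℝ) * (∑ i ∈ s, g i ^ 2) ^ (1 / 2 : ℝ) := h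
    _ ≤ (A ^ 2) ^ (1 / 2 : ℝ) * (B ^ 2) ^ (1 / 2 : ℝ) := by gcongr
    _ = A * B := by rw [hsqrt, hsqrt]

theorem Mesh.surf_facet_ne_top {d : ℕ} (hd : 1 ≤ d) {M : Mesh d} {κ : ℝ} (hκ : M.ShapeRegular κ)
    {F : Finset (Pt d)} (hF : F ∈ M.facets) : surf d (hull F) ≠ ⊤ := by
  classical
  obtain ⟨T, hT, hFT⟩ := Mesh.mem_facets.1 hF
  obtain ⟨a, ha, hFa⟩ := exists_erase_eq (M.card_eq T hT) hFT
  obtain ⟨ν, hν, hνF, -⟩ := M.exists_height_ge hd hκ hT ha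
  exact surf_hull_ne_top hd hν fun x hx => hνF x (by convert (hFa ▸ hx : x ∈ hull (T.erase a)))

/-- Constants are polynomials for every `p ≥ 0`, and on another facet the indicator vanishes almost
everywhere because the overlap is null. -/
theorem indicator_mem_pwPoly {d : ℕ} {M : Mesh d} {Γ : Set (Pt d)} {F : Finset (Pt d)}
    (hF : F ∈ M.boundary Γ) (hfin : surf d (hull F) ≠ ⊤) (p : ℕ) :
    (hull F).indicator (fun _ => (1 : ℝ)) ∈ pwPoly p (M.boundary Γ) Γ := by
  refine ⟨memLp_indicator_const 2 (measurableSet_hull F) 1 (.inr ?_), fun F' hF' => ?_⟩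
  · exact ((Measure.restrict_apply_le _ _).trans_lt hfin.lt_top).ne
  · rcases eq_or_ne F F' with rfl | hne
    · refine ⟨1, by simp, ?_⟩
      filter_upwards [ae_restrict_mem (measurableSet_hull F)] with x hx
      simp [hx, evalAt]
    · refine ⟨0, by simp, ?_⟩
      have h0 := M.surf_inter_eq_zero (Mesh.mem_boundary.1 hF).1 (Mesh.mem_boundary.1 hF').1 hne
      rw [ae_restrict_iff' (measurableSet_hull F')]
      filter_upwards [measure_eq_zero_iff_ae_notMem.1 h0] with x hx hxF'
      have : x ∉ hull F := fun h => hx ⟨h, hxF'⟩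
      simp [this, evalAt]

/-- By Galerkin orthogonality the residual has integral mean zero on every facet. -/
theorem IsGalerkin.integral_residual_eq_zero {d p : ℕ} {M : Mesh d} {Γ : Set (Pt d)} {g : HHalf Γ}
    {φ : Pt d → ℝ} {hφ : φ ∈ pwPoly p (M.boundary Γ) Γ} (h : IsGalerkin p (M.boundary Γ) g φ hφ)
    {F : Finset (Pt d)} (hF : F ∈ M.boundary Γ) (hfin : surf d (hull F) ≠ ⊤) :
    ∫ x in hull F, (g - singleLayer (ofL2 φ hφ.1)).fn x ∂(surf d) = 0 := by
  have hχ := indicator_mem_pwPoly hF hfin p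
  have h1 := h _ hχ
  have h2 : ofL2 _ hχ.1 (g - singleLayer (ofL2 φ hφ.1)) = 0 := by
    rw [map_sub, h1, sub_self]
  rw [ofL2_apply] at h2
  rw [← sigma_restrict_hull (Mesh.mem_boundary.1 hF).2, ← integral_indicator (measurableSet_hull F),
    ← h2]
  refine integral_congr_ae (.of_forall fun x => ?_)
  by_cases hx : x ∈ hull F <;> simp [hx]

/-- The weighted bound of a function with integral mean zero on all facets. -/
theorem Mesh.lintegral_enorm_mul_le {d : ℕ} (hd : 1 ≤ d) {M : Mesh d} {κ H : ℝ}
    (hκ : M.ShapeRegular κ) (hH : ∀ T ∈ M.elems, size T ≤ H) {Γ Ω Ω₀ : Set (Pt d)}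
    (hΩ : IsBoundedLipschitz Ω) (hΩ₀ : IsBoundedLipschitz Ω₀) (hcover : cover M.elems = closure Ω₀)
    (hΓ : frontier Ω = Γ) (hfr : Γ ⊆ frontier Ω₀) {q k : ℕ} (hk : 1 ≤ k)
    {v u w ψ : Pt d → ℝ} {p : Pt d → Pt d} (hv : MemLp v 2 (sigma Γ)) (hψ : MemLp ψ 2 (sigma Γ))
    (hv0 : ∀ F ∈ M.boundary Γ, ∫ x in hull F, v x ∂(surf d) = 0)
    (hw : IsAuxSolution q (M.kPatch Γ k) Γ u w) (hrp : HasSurfaceGradient Γ (v - u) p) :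
    ∫⁻ x, ‖v x * ψ x‖ₑ ∂(sigma Γ) ≤
      ENNReal.ofReal (2 ^ (d - 1) * (κ * √H)) *
        (eLpNorm (fun x => (M.h x) ^ (1 / 2 : ℝ) • p x) 2 (sigma Γ) * eLpNorm ψ 2 (sigma Γ))
      + ENNReal.ofReal (12 * 2 ^ (d - 1) * 2 ^ (d - 1) *
          (κ * √(unitBallVolume (d - 1) * κ ^ (d - 1)) * √H)) *
        ((d + 1 : ℕ) * ∑ T ∈ M.elems, eta w T *
          eLpNorm ψ 2 ((surf d).restrict (frontier (hull T) ∩ Γ))) := by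
  classical
  set K₁ := ENNReal.ofReal (2 ^ (d - 1) * (κ * √H))
  set K₂ := ENNReal.ofReal (12 * 2 ^ (d - 1) * 2 ^ (d - 1) *
    (κ * √(unitBallVolume (d - 1) * κ ^ (d - 1)) * √H))
  set m : Finset (Pt d) → Measure (Pt d) := fun F => (surf d).restrict (hull F)
  set Q : Pt d → Pt d := fun x => (M.h x) ^ (1 / 2 : ℝ) • p x
  have hle : ∀ F ∈ M.boundary Γ, m F ≤ sigma Γ := fun F hF =>
    restrict_hull_le_sigma (Mesh.mem_boundary.1 hF).2
  -- Assign to each boundary facet one element having it as a facet; the value `∅` elsewhere plays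
  -- no role.
  have hτ : ∀ F : Finset (Pt d), ∃ T, F ∈ M.boundary Γ → T ∈ M.elems ∧ F ∈ T.powersetCard d := by
    intro F
    by_cases hF : F ∈ M.boundary Γ
    · obtain ⟨T, hT⟩ := Mesh.mem_facets.1 (Mesh.mem_boundary.1 hF).1
      exact ⟨T, fun _ => hT⟩
    · exact ⟨∅, fun h => absurd h hF⟩
  choose τ hτ using hτ
  have hfacet : ∀ F ∈ M.boundary Γ,
      eLpNorm v 2 (m F) ≤ K₁ * eLpNorm Q 2 (m F) + K₂ * eta w (τ F) := by
    intro F hF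
    obtain ⟨hT, hFT⟩ := hτ F hF
    have hFΓ := (Mesh.mem_boundary.1 hF).2
    have hFsub : F ⊆ τ F := (Finset.mem_powersetCard.1 hFT).1
    have hne : (hull (τ F) ∩ Γ).Nonempty := by
      have h1 : F.Nonempty := by
        rw [← Finset.card_pos, (Finset.mem_powersetCard.1 hFT).2]; omega
      obtain ⟨x, hx⟩ := h1
      exact ⟨x, subset_hull (hFsub hx), hFΓ (subset_hull hx)⟩
    obtain ⟨P, -, hP⟩ := hw.mem (τ F) (M.mem_kPatch hT hne hk)
    rw [eta_eq_of_eqOn hP]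
    exact M.eLpNorm_facet_le hd hκ hT hFT (hH _ hT) hΩ₀ hcover hfr hFΓ hrp hv
      (sub_add_cancel v u).symm (hv0 F hF)
      fun x hx => by rw [← hw.eq_inner x (hFΓ hx), hP x (hull_mono hFsub hx)]
  have hsum : ∀ {G : Type} [NormedAddCommGroup G] (f : Pt d → G),
      ∑ F ∈ M.boundary Γ, eLpNorm f 2 (m F) ^ 2 ≤ eLpNorm f 2 (sigma Γ) ^ 2 := by
    intro G _ f
    rw [sq_eLpNorm_two, M.lintegral_sigma hd hΩ hΩ₀ hcover hΓ hfr]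
    simp_rw [sq_eLpNorm_two]
    exact le_rfl
  -- At most the `d + 1` facets of an element are assigned to it, and each lies in `frontier (hull
  -- T) ∩ Γ`.
  have hcount : ∑ F ∈ M.boundary Γ, eta w (τ F) * eLpNorm ψ 2 (m F)
      ≤ (d + 1 : ℕ) * ∑ T ∈ M.elems, eta w T *
          eLpNorm ψ 2 ((surf d).restrict (frontier (hull T) ∩ Γ)) := by
    rw [← Finset.sum_fiberwise_of_maps_to (fun F hF => (hτ F hF).1), Finset.mul_sum]
    refine Finset.sum_le_sum fun T hT => ?_
    have hterm : ∀ F ∈ (M.boundary Γ).filter (fun F => τ F = T),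
        eta w (τ F) * eLpNorm ψ 2 (m F) ≤
          eta w T * eLpNorm ψ 2 ((surf d).restrict (frontier (hull T) ∩ Γ)) := by
      intro F hF
      obtain ⟨hFb, rfl⟩ := Finset.mem_filter.1 hF
      refine mul_le_mul' le_rfl (eLpNorm_mono_measure ψ (Measure.restrict_mono ?_ le_rfl))
      obtain ⟨b, hb⟩ := exists_affineBasis (M.card_eq _ hT) (M.indep _ hT)
      obtain ⟨a, ha, hFa⟩ := exists_erase_eq (M.card_eq _ hT) (hτ F hFb).2
      refine Set.subset_inter (fun x hx => hull_erase_subset_frontier b hb ha ?_)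
        (Mesh.mem_boundary.1 hFb).2
      rw [hFa] at hx
      convert hx
    refine (Finset.sum_le_card_nsmul _ _ _ hterm).trans ?_
    rw [nsmul_eq_mul]
    gcongr
    calc _ ≤ (T.powersetCard d).card := by
          refine Finset.card_le_card fun F hF => ?_
          obtain ⟨hFb, rfl⟩ := Finset.mem_filter.1 hF
          exact (hτ F hFb).2
      _ = d + 1 := by
          rw [Finset.card_powersetCard, M.card_eq T hT, Nat.choose_succ_self_right]
  calc ∫⁻ x, ‖v x * ψ x‖ₑ ∂(sigma Γ)
      = ∑ F ∈ M.boundary Γ, ∫⁻ x, ‖v x * ψ x‖ₑ ∂(m F) :=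
        M.lintegral_sigma hd hΩ hΩ₀ hcover hΓ hfr _
    _ ≤ ∑ F ∈ M.boundary Γ, (K₁ * (eLpNorm Q 2 (m F) * eLpNorm ψ 2 (m F))
          + K₂ * (eta w (τ F) * eLpNorm ψ 2 (m F))) := by
        refine Finset.sum_le_sum fun F hF => ?_
        refine (BEM.lintegral_enorm_mul_le (hv.1.mono_measure (hle F hF))
          (hψ.1.mono_measure (hle F hF))).trans ?_
        refine (mul_le_mul_left (hfacet F hF) _).trans_eq ?_
        ring
    _ = K₁ * (∑ F ∈ M.boundary Γ, eLpNorm Q 2 (m F) * eLpNorm ψ 2 (m F))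
          + K₂ * ∑ F ∈ M.boundary Γ, eta w (τ F) * eLpNorm ψ 2 (m F) := by
        rw [Finset.sum_add_distrib, Finset.mul_sum, Finset.mul_sum]
    _ ≤ _ := by
        gcongr
        exact sum_mul_le_of_sum_sq_le _ _ _ (hsum Q) (hsum ψ)

end BEM

end

/-! ### The reliability estimate -/

theorem mainTheorem8 (d : ℕ) (hd : 2 ≤ d) (Γ : Set (BEM.Pt d)) (κ : ℝ) :
    ∃ C : ℝ, 0 < C ∧
      ∀ (Ω Ω₀ : Set (BEM.Pt d)) (M : BEM.Mesh d) (p q k : ℕ)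
        (J : BEM.ScottZhang q (M.boundary Γ)) (g : BEM.HHalf Γ) (φs : BEM.HMinusHalf Γ)
        (φ : BEM.Pt d → ℝ) (hφ : φ ∈ BEM.pwPoly p (M.boundary Γ) Γ) (w : BEM.Pt d → ℝ)
        (ψ : BEM.Pt d → ℝ) (hψ : MemLp ψ 2 (BEM.sigma Γ)),
        -- the domain and its boundary
        BEM.IsBoundedLipschitz Ω → IsConnected Ω → frontier Ω = Γ → BEM.IsPolyhedralSurface Γ →
        (d = 2 → Metric.diam Ω < 1) →
        -- the strip domain and its mesh
        BEM.IsBoundedLipschitz Ω₀ → Ω₀ ⊆ Ω → Γ ⊆ frontier Ω₀ →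
        BEM.cover M.elems = closure Ω₀ → M.ShapeRegular κ → 1 ≤ q → 1 ≤ k →
        -- the data, the exact density, the Galerkin density, and the auxiliary solution
        BEM.MemH1 Γ g.fn → BEM.IsExactDensity g φs → BEM.IsGalerkin p (M.boundary Γ) g φ hφ →
        BEM.IsAuxSolution q (M.kPatch Γ k) Γ
          (J.proj (g - BEM.singleLayer (BEM.ofL2 φ hφ.1)).fn) w →
        -- the estimate
        ENNReal.ofReal |BEM.ofL2 ψ hψ (BEM.singleLayer φs - BEM.singleLayer (BEM.ofL2 φ hφ.1))| ≤
          ENNReal.ofReal C *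
            (BEM.oscNorm M Γ ((g - BEM.singleLayer (BEM.ofL2 φ hφ.1)).fn
                - J.proj (g - BEM.singleLayer (BEM.ofL2 φ hφ.1)).fn)
              * eLpNorm ψ 2 (BEM.sigma Γ)
            + ∑ T ∈ M.elems, BEM.eta w T
              * eLpNorm ψ 2 ((BEM.surf d).restrict (frontier (BEM.hull T) ∩ Γ))) := by
  have hd1 : 1 ≤ d := by omega
  -- The constant is fixed before `Ω` is given, so the radius may depend on `Γ` only. The value `0`
  -- for unbounded `Γ` is a dummy.
  obtain ⟨R, hR0, hR⟩ : ∃ R : ℝ, 0 ≤ R ∧ (Bornology.IsBounded Γ → Γ ⊆ Metric.closedBall 0 R) := by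
    by_cases hb : Bornology.IsBounded Γ
    · obtain ⟨R, hR⟩ := hb.subset_closedBall 0
      exact ⟨max R 0, le_max_right _ _, fun _ =>
        hR.trans (Metric.closedBall_subset_closedBall (le_max_left _ _))⟩
    · exact ⟨0, le_rfl, fun h => absurd h hb⟩
  set H : ℝ := (volume.real (Metric.closedBall (0 : BEM.Pt d) R)) ^ (1 / (d : ℝ))
  set k₁ : ℝ := 2 ^ (d - 1) * (κ * √H)
  set k₂ : ℝ := 12 * 2 ^ (d - 1) * 2 ^ (d - 1) *
    (κ * √(BEM.unitBallVolume (d - 1) * κ ^ (d - 1)) * √H)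
  have h₁ : (0 : ℝ) ≤ max k₁ 0 := le_max_right _ _
  have h₂ : (0 : ℝ) ≤ max k₂ 0 * (d + 1 : ℕ) := mul_nonneg (le_max_right _ _) (Nat.cast_nonneg _)
  -- The maxima cover signs of `κ` not yet excluded, and the summand `1` makes the constant
  -- positive.
  refine ⟨max k₁ 0 + max k₂ 0 * (d + 1 : ℕ) + 1, by linarith, ?_⟩
  intro Ω Ω₀ M p q k J g φs φ hφ w ψ hψ hΩ _ hΓ _ _ hΩ₀ hsub hfr hcover hκ _ hk _ hφs hgal hw
  set C : ℝ := max k₁ 0 + max k₂ 0 * (d + 1 : ℕ) + 1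
  have hC₁ : ENNReal.ofReal k₁ ≤ ENNReal.ofReal C :=
    ENNReal.ofReal_le_ofReal ((le_max_left _ _).trans (by linarith))
  have hC₂ : ENNReal.ofReal k₂ * (d + 1 : ℕ) ≤ ENNReal.ofReal C := by
    rw [← ENNReal.ofReal_natCast, ← ENNReal.ofReal_mul' (Nat.cast_nonneg _)]
    refine ENNReal.ofReal_le_ofReal (le_trans ?_ (by linarith : max k₂ 0 * (d + 1 : ℕ) ≤ C))
    exact mul_le_mul_of_nonneg_right (le_max_left _ _) (Nat.cast_nonneg _)
  have hΓb : Bornology.IsBounded Γ := by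
    rw [← hΓ]
    exact hΩ.isBounded.closure.subset frontier_subset_closure
  have hball : closure Ω ⊆ Metric.closedBall 0 R :=
    hΩ.subset_closedBall hR0 (hΓ ▸ hR hΓb)
  have hH : ∀ T ∈ M.elems, BEM.size T ≤ H := fun T hT =>
    BEM.size_le_of_subset_closedBall (R := R)
      (((Set.subset_biUnion_of_mem (u := fun T => BEM.hull T) hT).trans
        (hcover.le.trans (closure_mono hsub))).trans hball)
  set e := g - BEM.singleLayer (BEM.ofL2 φ hφ.1) with he
  have hlhs : BEM.ofL2 ψ hψ (BEM.singleLayer φs - BEM.singleLayer (BEM.ofL2 φ hφ.1))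
      = ∫ x, e.fn x * ψ x ∂(BEM.sigma Γ) := by
    rw [← BEM.ofL2_apply ψ hψ, he, map_sub, map_sub, hφs]
  have hle : ENNReal.ofReal |BEM.ofL2 ψ hψ (BEM.singleLayer φs
      - BEM.singleLayer (BEM.ofL2 φ hφ.1))| ≤ ∫⁻ x, ‖e.fn x * ψ x‖ₑ ∂(BEM.sigma Γ) := by
    rw [hlhs, ← Real.enorm_eq_ofReal_abs]
    exact enorm_integral_le_lintegral_enorm _
  refine hle.trans ?_
  have hem : MemLp e.fn 2 (BEM.sigma Γ) := e.2.1
  -- The oscillation may be infinite. Pulling the norm of `ψ` into the infimum requires it to be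
  -- nonzero; if it is zero, the left side vanishes.
  rcases eq_or_ne (eLpNorm ψ 2 (BEM.sigma Γ)) 0 with h0 | h0
  · refine (BEM.lintegral_enorm_mul_le hem.1 hψ.1).trans ?_
    rw [h0, mul_zero]
    exact zero_le
  have hv0 : ∀ F ∈ M.boundary Γ, ∫ x in BEM.hull F, e.fn x ∂(BEM.surf d) = 0 := fun F hF =>
    hgal.integral_residual_eq_zero hF
      (BEM.Mesh.surf_facet_ne_top hd1 hκ (BEM.Mesh.mem_boundary.1 hF).1)
  have hC0 : ENNReal.ofReal C ≠ 0 := (ENNReal.ofReal_pos.2 (by linarith)).ne'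
  -- The bound is proved for each surface gradient of `(1 - J)e`; if there is none, the infimum is
  -- infinite.
  rw [BEM.oscNorm, iInf_subtype', ENNReal.iInf_mul_of_ne h0 hψ.2.ne, ENNReal.iInf_add,
    ENNReal.mul_iInf_of_ne hC0 ENNReal.ofReal_ne_top]
  refine le_iInf fun s => ?_
  refine (BEM.Mesh.lintegral_enorm_mul_le hd1 hκ hH hΩ hΩ₀ hcover hΓ hfr hk hem hψ hv0 hw
    s.2).trans ?_
  rw [mul_add, ← mul_assoc (ENNReal.ofReal k₂)]
  gcongr
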